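/- Let $n\ge 2$ and let $x_1,\dots,x_n$ be distinct points of the unit circle $\partial\mathbb{D}$. Then there are $m\in\mathbb{N}$, distinct points $a_1,\dots,a_m\in\mathbb{C}\setminus\{x_1,\dots,x_n\}$ and real charges $q_1,\dots,q_m$ such that unit charges at the $x_j$ are in total electrostatic equilibrium in the field generated by the charges $q_i$ at $a_i$, i.e. \[ \sum_{k\ne j}\frac{1}{x_j-x_k}+\sum_{i=1}^m\frac{q_i}{x_j-a_i}=0,\qquad j=1,\dots,n. \tag{1} \] Moreover, such generators are given by the following explicit construction. For a measure $\mu$ on $\partial\mathbb{D}$ let $\Phi_k(\cdot;\mu)$ and $\varphi_k(\cdot;\mu)$ be the monic orthogonal and the orthonormal polynomials obtained from $1,z,z^2,\dots$ by Gram--Schmidt in $L^2(\mu)$, let $\alpha_k(\mu)=-\overline{\Phi_{k+1}(0;\mu)}$ be the Verblunsky coefficients, and put $\varphi_k^*(z)=z^k\overline{\varphi_k(1/\bar z)}$. For a measure $\mu = w(\theta)\frac{d\theta}{2\pi}$ with differentiable weight $w$ and $|z|>1$ put \[ G_n(z)=i\int_0^{2\pi}\frac{|\varphi_{n-1}^*(e^{i\theta})|^2w'(\theta)}{z-e^{i\theta}}\frac{d\theta}{2\pi},\qquad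 D_n(z)=-iz\int_0^{2\pi}\frac{\varphi_{n-1}^*(e^{i\theta})^2w'(\theta)}{(z-e^{i\theta})e^{in\theta}}\frac{d\theta}{2\pi}, \] \[ J_n(z)=i\int_0^{2\pi}\frac{\varphi_{n-1}(e^{i\theta})^2w'(\theta)}{(z-e^{i\theta})e^{i(n-2)\theta}}\frac{d\theta}{2\pi}, \] \[ h_n(z;x;y)=\bar x\bigl(n(1-\bar y\alpha_{n-1})+zG_n(z)+\bar yD_n(z)\bigr)-z\bigl(J_n(z)-\bar yG_n(z)\bigr). \] Let $\mu_n=\frac1n\sum_{j=1}^n\delta_{x_j}$, $\beta=(-1)^{n+1}\prod_{j=1}^n\bar x_j$ and $d\nu_n=|\varphi_{n-1}(e^{i\theta};\mu_n)|^{-2}\frac{d\theta}{2\pi}$. Then: (a) $\nu_n$ is a probability measure; (b) for the measure $\nu_n$, the function $h_n(z;\beta;\beta)$ coincides on $\{|z|>1\}$ with a quotient $S_1(z)/S_2(z)$ of coprime polynomials; (c) for all polynomials $S_1$ and $S_2\not\equiv0$ such that $h_n(z;\beta;\beta)\,S_2(z)=S_1(z)$ for $|z|>1$ and such that no $x_j$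 is a common zero of $S_1$ and $S_2$ (in particular, for coprime ones), no $x_j$ is a zero of $S_1$ or of $S_2$, and (1) holds for the following generators: a charge $-\frac12$ at each zero of $S_1$, a charge $+\frac12$ at each zero of $S_2$ (zeros counted with multiplicity, charges at the same point added), and a charge $\frac12(1-n)$ at the origin. -/

import Mathlib

namespace CircleElectro

open Polynomial MeasureTheory

/-- The inner product `⟨p, q⟩ = ∫ conj (p z) q z dμ(z)` of two polynomials in `L²(μ)`. -/
noncomputable def polyInner (μ : Measure ℂ) (p q : ℂ[X]) : ℂ :=
  ∫ z, (starRingEnd ℂ) (p.eval z) * q.eval z ∂μ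

/-- Gram–Schmidt orthogonalization of `1, z, z², …` in `L²(μ)`:
the monic orthogonal polynomials `Φ_k(z; μ)`. -/
noncomputable def monicOP (μ : Measure ℂ) : ℕ → ℂ[X]
  | k => X ^ k - ∑ j : Fin k,
      C (polyInner μ (monicOP μ j) (X ^ k) / polyInner μ (monicOP μ j) (monicOP μ j))
        * monicOP μ j
  termination_by k => k
  decreasing_by all_goals exact j.2

/-- The orthonormal polynomials `φ_k(z; μ) = Φ_k(z; μ) / ‖Φ_k‖`. -/
noncomputable def orthonormalOP (μ : Measure ℂ) (k : ℕ) : ℂ[X] :=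
  C ((1 / Real.sqrt (∫ z, ‖(monicOP μ k).eval z‖ ^ 2 ∂μ) : ℝ) : ℂ) * monicOP μ k

/-- The reversed polynomial `p^*(z) = z^k conj (p (1 / conj z))` of a polynomial of degree
at most `k`: the coefficient of `z^i` is the conjugate of the coefficient of `z^(k-i)` in `p`. -/
noncomputable def revPoly (k : ℕ) (p : ℂ[X]) : ℂ[X] :=
  (p.map (starRingEnd ℂ)).reflect k

/-- The Verblunsky coefficient `α_k = - conj (Φ_{k+1}(0))`, i.e. the value at `0` of the
Szegő recursion `Φ_{k+1} = z Φ_k - conj α_k Φ_k^*`. -/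
noncomputable def verblunsky (μ : Measure ℂ) (k : ℕ) : ℂ :=
  -(starRingEnd ℂ) ((monicOP μ (k + 1)).eval 0)

/-- The point `e^{iθ}` of the unit circle. -/
noncomputable def expI (θ : ℝ) : ℂ := Complex.exp (θ * Complex.I)

/-- The measure `w(θ) dθ / (2π)` on the unit circle, as a measure on `ℂ`. -/
noncomputable def circleMeasure (w : ℝ → ℝ) : Measure ℂ :=
  ((volume.restrict (Set.Ioc 0 (2 * Real.pi))).withDensity
    (fun θ => ENNReal.ofReal (w θ / (2 * Real.pi)))).map expI

/-- `G_n(z)` for the measure `w(θ) dθ / (2π)`. -/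
noncomputable def Gfun (w : ℝ → ℝ) (n : ℕ) (z : ℂ) : ℂ :=
  Complex.I * ∫ θ in (0 : ℝ)..(2 * Real.pi),
    ((‖(revPoly (n - 1) (orthonormalOP (circleMeasure w) (n - 1))).eval (expI θ)‖ ^ 2 : ℝ) : ℂ)
      * ((deriv w θ : ℝ) : ℂ) / (z - expI θ) / (2 * Real.pi)

/-- `D_n(z)` for the measure `w(θ) dθ / (2π)`. -/
noncomputable def Dfun (w : ℝ → ℝ) (n : ℕ) (z : ℂ) : ℂ :=
  -Complex.I * z * ∫ θ in (0 : ℝ)..(2 * Real.pi),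
    ((revPoly (n - 1) (orthonormalOP (circleMeasure w) (n - 1))).eval (expI θ)) ^ 2
      * ((deriv w θ : ℝ) : ℂ) / ((z - expI θ) * expI θ ^ n) / (2 * Real.pi)

/-- `J_n(z)` for the measure `w(θ) dθ / (2π)`. -/
noncomputable def Jfun (w : ℝ → ℝ) (n : ℕ) (z : ℂ) : ℂ :=
  Complex.I * ∫ θ in (0 : ℝ)..(2 * Real.pi),
    ((orthonormalOP (circleMeasure w) (n - 1)).eval (expI θ)) ^ 2
      * ((deriv w θ : ℝ) : ℂ) / ((z - expI θ) * expI θ ^ ((n : ℤ) - 2)) / (2 * Real.pi)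

/-- `h_n(z; x; y)` for the measure `w(θ) dθ / (2π)`. -/
noncomputable def hfun (w : ℝ → ℝ) (n : ℕ) (z x y : ℂ) : ℂ :=
  (starRingEnd ℂ) x * (n * (1 - (starRingEnd ℂ) y * verblunsky (circleMeasure w) (n - 1))
      + z * Gfun w n z + (starRingEnd ℂ) y * Dfun w n z)
    - z * (Jfun w n z - (starRingEnd ℂ) y * Gfun w n z)

/-- The uniform probability measure on the points `x_1, …, x_n`. -/
noncomputable def uniformMeasure {n : ℕ} (x : Fin n → ℂ) : Measure ℂ :=
  (n : ENNReal)⁻¹ • ∑ j, Measure.dirac (x j)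

/-- `β = (-1)^(n+1) ∏ conj x_j`. -/
noncomputable def betaOf {n : ℕ} (x : Fin n → ℂ) : ℂ :=
  (-1) ^ (n + 1) * ∏ j, (starRingEnd ℂ) (x j)

/-- The Bernstein–Szegő weight `w(θ) = 1 / |φ_{n-1}(e^{iθ}; μ_n)|²`, where `μ_n` is the
uniform measure on the given points. -/
noncomputable def bsWeight {n : ℕ} (x : Fin n → ℂ) (θ : ℝ) : ℝ :=
  1 / ‖(orthonormalOP (uniformMeasure x) (n - 1)).eval (expI θ)‖ ^ 2

/-- Unit charges at the points `x_j` are in total electrostatic equilibrium in the field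
generated by charges `q_i` at the points `a_i`. -/
def TotalEquilibrium {n : ℕ} {ι : Type*} [Fintype ι]
    (x : Fin n → ℂ) (a : ι → ℂ) (q : ι → ℝ) : Prop :=
  ∀ j, ∑ k ∈ Finset.univ.erase j, 1 / (x j - x k) + ∑ i, (q i : ℂ) / (x j - a i) = 0

/-- The positions of the generators built from `S₁ / S₂`: the origin and all the zeros
of `S₁` and `S₂`. -/
noncomputable def genPoints (S₁ S₂ : ℂ[X]) : Finset ℂ :=
  insert 0 (S₁.roots.toFinset ∪ S₂.roots.toFinset)

/-- The total charge at `a`: `-1/2` for each zero of `S₁`, `+1/2` for each zero of `S₂` (zeros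
counted with multiplicity), and `(1 - n)/2` at the origin. -/
noncomputable def genCharge (n : ℕ) (S₁ S₂ : ℂ[X]) (a : ℂ) : ℝ :=
  -(1 / 2) * (S₁.rootMultiplicity a : ℝ) + 1 / 2 * (S₂.rootMultiplicity a : ℝ)
    + (if a = 0 then (1 - (n : ℝ)) / 2 else 0)

/-- `S₁ / S₂` represents the function `h` on `{|z| > 1}`. -/
def Represents (S₁ S₂ : ℂ[X]) (h : ℂ → ℂ) : Prop :=
  S₂ ≠ 0 ∧ ∀ z : ℂ, 1 < ‖z‖ → h z * S₂.eval z = S₁.eval z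

end CircleElectro

/-!
Write `N = n - 1`, `φ = φ_N(·; μ_n)`, `b = conj β` and `P = z φ - b φ^*`. By orthogonality `P` is a
constant multiple of `∏ (z - x_j)`. All zeros of `φ` lie in the open unit disc, and `φ` is also the
orthonormal polynomial of degree `N` of `ν_n`, with `α_N(ν_n) = 0`; since an orthonormal polynomial
determines the total mass of its measure, `ν_n` is a probability measure.

On the circle the weight of `ν_n` is the rational function `z ^ N / (φ φ^*)`, so Cauchy's formula
evaluates `G_n`, `D_n`, `J_n` and gives `h_n(z; β; β) = b z ^ N φ⁻² (z ^ (-N) φ P)'`. At a simple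
zero `x_j` of `P` this yields `h_n' / h_n = P'' / P' - N / z`, where `P'' / P'` is twice the field
of the unit charges at the other points. Equating it with `S₁' / S₁ - S₂' / S₂` gives the
equilibrium.
-/

namespace CircleElectro

open Polynomial MeasureTheory
open scoped ComplexConjugate

/-- All products `conj p * q` of polynomials are integrable, so that `polyInner μ` is
sesquilinear. -/
def PolyIntegrable (μ : Measure ℂ) : Prop :=
  ∀ p q : ℂ[X], Integrable (fun z => conj (p.eval z) * q.eval z) μ

/-- The inner product of `L²(μ)` is definite on the polynomials of degree less than `K`. -/
def DefiniteBelow (μ : Measure ℂ) (K : ℕ) : Prop :=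
  ∀ p : ℂ[X], p.degree < K → polyInner μ p p = 0 → p = 0

/-- The polynomial `p` is orthogonal in `L²(μ)` to all polynomials of degree less than `k`. -/
def OrthogonalBelow (μ : Measure ℂ) (k : ℕ) (p : ℂ[X]) : Prop :=
  ∀ q : ℂ[X], q.degree < k → polyInner μ p q = 0

lemma degree_sub_lt_of_coeff_eq {R : Type*} [Ring R] {n : ℕ} {p q : R[X]} (hp : p.natDegree ≤ n)
    (hq : q.natDegree ≤ n) (h : p.coeff n = q.coeff n) : (p - q).degree < n := by
  refine (degree_lt_iff_coeff_zero _ _).2 fun i hi => ?_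
  rcases hi.eq_or_lt with rfl | hni
  · rw [coeff_sub, h, sub_self]
  · exact coeff_eq_zero_of_natDegree_lt
      (((natDegree_sub_le p q).trans (max_le hp hq)).trans_lt hni)

section InnerProduct

variable {μ : Measure ℂ} {k : ℕ} {p : ℂ[X]}

lemma polyInner_zero_right (p : ℂ[X]) : polyInner μ p 0 = 0 := by simp [polyInner]

lemma polyInner_add_right (hμ : PolyIntegrable μ) (p q r : ℂ[X]) :
    polyInner μ p (q + r) = polyInner μ p q + polyInner μ p r := by
  simp only [polyInner, eval_add, mul_add]
  exact integral_add (hμ p q) (hμ p r)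

lemma polyInner_sub_right (hμ : PolyIntegrable μ) (p q r : ℂ[X]) :
    polyInner μ p (q - r) = polyInner μ p q - polyInner μ p r := by
  simp only [polyInner, eval_sub, mul_sub]
  exact integral_sub (hμ p q) (hμ p r)

lemma polyInner_C_mul_right (c : ℂ) (p q : ℂ[X]) :
    polyInner μ p (C c * q) = c * polyInner μ p q := by
  simp only [polyInner, eval_mul, eval_C, ← integral_const_mul, mul_left_comm]

lemma polyInner_sum_right (hμ : PolyIntegrable μ) {ι : Type*} (s : Finset ι) (p : ℂ[X])
    (f : ι → ℂ[X]) : polyInner μ p (∑ i ∈ s, f i) = ∑ i ∈ s, polyInner μ p (f i) := by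
  simp only [polyInner, eval_finsetSum, Finset.mul_sum]
  exact integral_finsetSum _ fun i _ => hμ p (f i)

lemma conj_polyInner (p q : ℂ[X]) :
    conj (polyInner μ p q) = polyInner μ q p := by
  simp only [polyInner, ← integral_conj, map_mul, Complex.conj_conj, mul_comm]

lemma polyInner_eq_zero_symm {p q : ℂ[X]} (h : polyInner μ p q = 0) : polyInner μ q p = 0 := by
  rw [← conj_polyInner, h, map_zero]

lemma polyInner_add_left (hμ : PolyIntegrable μ) (p q r : ℂ[X]) :
    polyInner μ (p + q) r = polyInner μ p r + polyInner μ q r := by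
  rw [← conj_polyInner, polyInner_add_right hμ, map_add, conj_polyInner, conj_polyInner]

lemma polyInner_C_mul_left (c : ℂ) (p q : ℂ[X]) :
    polyInner μ (C c * p) q = conj c * polyInner μ p q := by
  rw [← conj_polyInner, polyInner_C_mul_right, map_mul, conj_polyInner]

lemma polyInner_self (p : ℂ[X]) : polyInner μ p p = ((∫ z, ‖p.eval z‖ ^ 2 ∂μ : ℝ) : ℂ) := by
  simp only [polyInner, ← integral_complex_ofReal, Complex.conj_mul', Complex.ofReal_pow]

lemma polyInner_one_one : polyInner μ 1 1 = μ.real Set.univ := by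
  simp [polyInner]

lemma polyIntegrable_of_ae_norm_le [IsFiniteMeasure μ] {R : ℝ} (h : ∀ᵐ z ∂μ, ‖z‖ ≤ R) :
    PolyIntegrable μ := fun p q => by
  have hcont : Continuous fun z : ℂ => conj (p.eval z) * q.eval z := by fun_prop
  have hball : ∀ᵐ z ∂μ, z ∈ Metric.closedBall (0 : ℂ) R := by simpa using h
  rw [← Measure.restrict_eq_self_of_ae_mem hball]
  exact hcont.continuousOn.integrableOn_compact (isCompact_closedBall 0 R)

lemma DefiniteBelow.mono {j : ℕ} (hd : DefiniteBelow μ k) (hjk : j ≤ k) : DefiniteBelow μ j :=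
  fun p hp => hd p (hp.trans_le (by exact_mod_cast hjk))

lemma DefiniteBelow.polyInner_self_ne_zero (hd : DefiniteBelow μ (k + 1)) (hp : p.degree = k) :
    polyInner μ p p ≠ 0 := fun h => by
  have h0 : p = 0 := hd p (by rw [hp]; exact_mod_cast k.lt_succ_self) h
  simp [h0] at hp

lemma DefiniteBelow.integral_norm_sq_pos (hd : DefiniteBelow μ (k + 1)) (hp : p.degree = k) :
    0 < ∫ z, ‖p.eval z‖ ^ 2 ∂μ := by
  have hne := hd.polyInner_self_ne_zero hp
  rw [polyInner_self, Complex.ofReal_ne_zero] at hne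
  exact (integral_nonneg fun z => by positivity).lt_of_ne' hne

/-- A polynomial of zero norm vanishes almost everywhere, so its roots carry `μ`. -/
lemma definiteBelow_of_measure_compl_ne_zero (hμ : PolyIntegrable μ)
    (h : ∀ s : Finset ℂ, s.card < k → μ (↑s)ᶜ ≠ 0) : DefiniteBelow μ k := by
  intro p hp hpp
  by_contra hp0
  have hint : Integrable (fun z => ‖p.eval z‖ ^ 2) μ := by
    simpa only [Complex.conj_mul', ← Complex.ofReal_pow, RCLike.re_to_complex,
      Complex.ofReal_re] using (hμ p p).re
  rw [polyInner_self, Complex.ofReal_eq_zero,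
    integral_eq_zero_iff_of_nonneg (fun z => sq_nonneg _) hint] at hpp
  have hcard : p.roots.toFinset.card < k := (Multiset.toFinset_card_le _).trans_lt <|
    (card_roots' p).trans_lt ((natDegree_lt_iff_degree_lt hp0).2 hp)
  refine h p.roots.toFinset hcard (ae_iff.1 (hpp.mono fun z hz => ?_))
  simpa [hp0] using hz

lemma OrthogonalBelow.C_mul (hp : OrthogonalBelow μ k p) (c : ℂ) :
    OrthogonalBelow μ k (C c * p) := fun q hq => by
  rw [polyInner_C_mul_left, hp q hq, mul_zero]

/-- Only the leading term of `q` contributes, since `q` is a multiple of `p` up to terms of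
lower degree. -/
lemma OrthogonalBelow.polyInner_eq (hμ : PolyIntegrable μ) (hp : OrthogonalBelow μ k p)
    (hpk : p.degree = k) {q : ℂ[X]} (hq : q.natDegree ≤ k) :
    polyInner μ p q = q.coeff k / p.coeff k * polyInner μ p p := by
  have hlc : p.coeff k ≠ 0 := coeff_ne_zero_of_eq_degree hpk
  have hlt : (q - C (q.coeff k / p.coeff k) * p).degree < k :=
    degree_sub_lt_of_coeff_eq hq
      ((natDegree_C_mul_le _ _).trans (natDegree_eq_of_degree_eq_some hpk).le)
      (by rw [coeff_C_mul, div_mul_cancel₀ _ hlc])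
  rw [← sub_eq_zero, ← polyInner_C_mul_right, ← polyInner_sub_right hμ, hp _ hlt]

end InnerProduct

section GramSchmidt

variable {μ : Measure ℂ} {k : ℕ}

lemma monicOP_eq (μ : Measure ℂ) (k : ℕ) : monicOP μ k = X ^ k - ∑ j : Fin k,
    C (polyInner μ (monicOP μ j) (X ^ k) / polyInner μ (monicOP μ j) (monicOP μ j))
      * monicOP μ j := by
  rw [monicOP]

lemma degree_X_pow_sub_monicOP_lt (μ : Measure ℂ) (k : ℕ) :
    (X ^ k - monicOP μ k : ℂ[X]).degree < k := by
  induction k using Nat.strong_induction_on with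
  | _ k ih =>
    rw [monicOP_eq, sub_sub_cancel]
    refine (degree_sum_le _ _).trans_lt ((Finset.sup_lt_iff (WithBot.bot_lt_coe k)).2 ?_)
    intro j _
    have hj : (monicOP μ j).degree ≤ (j : ℕ) := by
      rw [← sub_sub_self (X ^ (j : ℕ)) (monicOP μ j)]
      exact (degree_sub_le _ _).trans (max_le (degree_X_pow_le _) (ih j j.2).le)
    rw [← smul_eq_C_mul]
    exact (degree_smul_le _ _).trans_lt (hj.trans_lt (Nat.cast_lt.2 j.2))

lemma monic_monicOP (μ : Measure ℂ) (k : ℕ) : (monicOP μ k).Monic := by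
  rw [← sub_sub_self (X ^ k) (monicOP μ k)]
  exact monic_X_pow_sub (degree_X_pow_sub_monicOP_lt μ k)

lemma degree_monicOP (μ : Measure ℂ) (k : ℕ) : (monicOP μ k).degree = k := by
  rw [← sub_sub_self (X ^ k) (monicOP μ k), degree_sub_eq_left_of_degree_lt, degree_X_pow]
  simpa using degree_X_pow_sub_monicOP_lt μ k

lemma coeff_monicOP_self (μ : Measure ℂ) (k : ℕ) : (monicOP μ k).coeff k = 1 := by
  simpa only [natDegree_eq_of_degree_eq_some (degree_monicOP μ k)] using
    (monic_monicOP μ k).coeff_natDegree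

lemma orthogonalBelow_of_polyInner_monicOP_eq_zero (hμ : PolyIntegrable μ) {p : ℂ[X]}
    (h : ∀ j < k, polyInner μ p (monicOP μ j) = 0) : OrthogonalBelow μ k p := by
  intro q hqk
  let S : Polynomial.Sequence ℂ := ⟨monicOP μ, degree_monicOP μ⟩
  have hspan : q ∈ Submodule.span ℂ (S '' Set.Iio k) := by
    rw [S.span_degreeLT fun j _ => (monic_monicOP μ j).leadingCoeff ▸ isUnit_one]
    exact mem_degreeLT.2 hqk
  clear hqk
  induction hspan using Submodule.span_induction with
  | mem _ hq => obtain ⟨j, hj, rfl⟩ := hq; exact h j hj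
  | zero => exact polyInner_zero_right p
  | add q r _ _ hq hr => rw [polyInner_add_right hμ, hq, hr, add_zero]
  | smul c q _ hq => rw [smul_eq_C_mul, polyInner_C_mul_right, hq, mul_zero]

lemma orthogonalBelow_monicOP (hμ : PolyIntegrable μ) (hd : DefiniteBelow μ k) :
    OrthogonalBelow μ k (monicOP μ k) := by
  induction k using Nat.strong_induction_on with
  | _ k ih =>
    have hpair : ∀ i < k, ∀ j < k, i ≠ j → polyInner μ (monicOP μ i) (monicOP μ j) = 0 := by
      have hlt : ∀ i < k, ∀ j < i, polyInner μ (monicOP μ i) (monicOP μ j) = 0 :=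
        fun i hi j hj => ih i hi (hd.mono hi.le) _ (by rw [degree_monicOP]; exact_mod_cast hj)
      intro i hi j hj hij
      rcases hij.lt_or_gt with h | h
      · exact polyInner_eq_zero_symm (hlt j hj i h)
      · exact hlt i hi j h
    refine orthogonalBelow_of_polyInner_monicOP_eq_zero hμ fun j hj => polyInner_eq_zero_symm ?_
    have hne : polyInner μ (monicOP μ j) (monicOP μ j) ≠ 0 :=
      (hd.mono hj).polyInner_self_ne_zero (degree_monicOP μ j)
    rw [monicOP_eq μ k, polyInner_sub_right hμ, polyInner_sum_right hμ,
      Finset.sum_eq_single (⟨j, hj⟩ : Fin k), polyInner_C_mul_right, div_mul_cancel₀ _ hne,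
      sub_self]
    · intro i _ hij
      rw [polyInner_C_mul_right, hpair j hj i i.2 fun h => hij (Fin.ext h.symm), mul_zero]
    · simp

lemma monicOP_eq_of_orthogonalBelow (hμ : PolyIntegrable μ) (hd : DefiniteBelow μ k) {p : ℂ[X]}
    (hp : OrthogonalBelow μ k p) (hpk : p.degree = k) : monicOP μ k = C (p.coeff k)⁻¹ * p := by
  have hlt : (monicOP μ k - C (p.coeff k)⁻¹ * p).degree < k :=
    degree_sub_lt_of_coeff_eq (natDegree_eq_of_degree_eq_some (degree_monicOP μ k)).le
      ((natDegree_C_mul_le _ _).trans (natDegree_eq_of_degree_eq_some hpk).le)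
      (by rw [coeff_monicOP_self, coeff_C_mul, inv_mul_cancel₀ (coeff_ne_zero_of_eq_degree hpk)])
  refine sub_eq_zero.1 (hd _ hlt ?_)
  rw [polyInner_sub_right hμ, polyInner_eq_zero_symm (orthogonalBelow_monicOP hμ hd _ hlt),
    polyInner_eq_zero_symm (hp.C_mul _ _ hlt), sub_zero]

lemma orthogonalBelow_orthonormalOP (hμ : PolyIntegrable μ) (hd : DefiniteBelow μ k) :
    OrthogonalBelow μ k (orthonormalOP μ k) :=
  (orthogonalBelow_monicOP hμ hd).C_mul _

lemma degree_orthonormalOP (hd : DefiniteBelow μ (k + 1)) : (orthonormalOP μ k).degree = k := by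
  have hpos := hd.integral_norm_sq_pos (degree_monicOP μ k)
  rw [orthonormalOP, degree_C_mul, degree_monicOP]
  exact Complex.ofReal_ne_zero.2 (one_div_pos.2 (Real.sqrt_pos.2 hpos)).ne'

lemma norm_coeff_orthonormalOP (μ : Measure ℂ) (k : ℕ) :
    (‖(orthonormalOP μ k).coeff k‖ : ℂ) = (orthonormalOP μ k).coeff k := by
  rw [orthonormalOP, coeff_C_mul, coeff_monicOP_self, mul_one,
    Complex.norm_of_nonneg (by positivity)]

lemma polyInner_orthonormalOP_self (hd : DefiniteBelow μ (k + 1)) :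
    polyInner μ (orthonormalOP μ k) (orthonormalOP μ k) = 1 := by
  have hpos := hd.integral_norm_sq_pos (degree_monicOP μ k)
  simp only [polyInner_self, orthonormalOP, eval_C_mul, norm_mul, mul_pow, integral_const_mul,
    Complex.norm_real, Real.norm_eq_abs, sq_abs, div_pow, one_pow, Real.sq_sqrt hpos.le]
  rw [one_div_mul_cancel hpos.ne', Complex.ofReal_one]

lemma orthonormalOP_eq_of_orthogonalBelow (hμ : PolyIntegrable μ) (hd : DefiniteBelow μ k)
    {φ : ℂ[X]} (hφ : OrthogonalBelow μ k φ) (hdeg : φ.degree = k) (hnorm : polyInner μ φ φ = 1)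
    (hcoeff : (‖φ.coeff k‖ : ℂ) = φ.coeff k) : orthonormalOP μ k = φ := by
  have hlc : φ.coeff k ≠ 0 := coeff_ne_zero_of_eq_degree hdeg
  have hmonic := monicOP_eq_of_orthogonalBelow hμ hd hφ hdeg
  have hint : ∫ z, ‖φ.eval z‖ ^ 2 ∂μ = 1 := by
    exact_mod_cast (polyInner_self φ).symm.trans hnorm
  have hsqrt : 1 / Real.sqrt (∫ z, ‖(monicOP μ k).eval z‖ ^ 2 ∂μ) = ‖φ.coeff k‖ := by
    simp only [hmonic, eval_C_mul, norm_mul, mul_pow, integral_const_mul, hint, mul_one,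
      Real.sqrt_sq (norm_nonneg _), norm_inv, one_div, inv_inv, inv_pow, Real.sqrt_inv]
  rw [orthonormalOP, hsqrt, hcoeff, hmonic, ← mul_assoc, ← C_mul, mul_inv_cancel₀ hlc, C_1,
    one_mul]

end GramSchmidt

section Reversal

variable {k : ℕ} {p : ℂ[X]}

lemma eval_revPoly (hp : p.natDegree ≤ k) {z : ℂ} (hz : z ≠ 0) :
    (revPoly k p).eval z = z ^ k * conj (p.eval (conj z)⁻¹) := by
  let _ : Invertible z⁻¹ := invertibleOfNonzero (inv_ne_zero hz)
  have h := eval₂_reflect_mul_pow (RingHom.id ℂ) z⁻¹ k (p.map (starRingEnd ℂ))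
    (natDegree_map_le.trans hp)
  have hconj := eval_map_apply (f := starRingEnd ℂ) (p := p) (conj z)⁻¹
  simp only [invOf_eq_inv, inv_inv, eval₂_id, inv_pow] at h
  rw [map_inv₀, Complex.conj_conj] at hconj
  rw [revPoly, ← hconj, ← h, mul_left_comm, mul_inv_cancel₀ (pow_ne_zero k hz), mul_one]

lemma eval_revPoly_of_norm_eq_one (hp : p.natDegree ≤ k) {ζ : ℂ} (hζ : ‖ζ‖ = 1) :
    (revPoly k p).eval ζ = ζ ^ k * conj (p.eval ζ) := by
  rw [eval_revPoly hp (norm_ne_zero_iff.1 (by simp [hζ])), ← Complex.inv_eq_conj hζ, inv_inv]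

lemma eval_zero_revPoly (k : ℕ) (p : ℂ[X]) : (revPoly k p).eval 0 = conj (p.coeff k) := by
  rw [← coeff_zero_eq_eval_zero, revPoly, coeff_reflect, revAt_zero, coeff_map]

lemma coeff_revPoly_self (k : ℕ) (p : ℂ[X]) : (revPoly k p).coeff k = conj (p.coeff 0) := by
  rw [revPoly, coeff_reflect, revAt_le le_rfl, Nat.sub_self, coeff_map]

lemma natDegree_revPoly_le (hp : p.natDegree ≤ k) : (revPoly k p).natDegree ≤ k :=
  natDegree_reflect_le.trans (max_le le_rfl (natDegree_map_le.trans hp))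

/-- A polynomial of exact degree `N` is Schur stable if all its zeros lie in the open unit
disc. -/
structure IsSchurStable (N : ℕ) (φ : ℂ[X]) : Prop where
  degree_eq : φ.degree = N
  norm_lt_one : ∀ ζ : ℂ, φ.eval ζ = 0 → ‖ζ‖ < 1

namespace IsSchurStable

variable {N : ℕ} {φ : ℂ[X]}

lemma natDegree_eq (hφ : IsSchurStable N φ) : φ.natDegree = N :=
  natDegree_eq_of_degree_eq_some hφ.degree_eq

lemma coeff_ne_zero (hφ : IsSchurStable N φ) : φ.coeff N ≠ 0 :=
  coeff_ne_zero_of_eq_degree hφ.degree_eq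

lemma eval_ne_zero (hφ : IsSchurStable N φ) {ζ : ℂ} (hζ : 1 ≤ ‖ζ‖) : φ.eval ζ ≠ 0 :=
  fun h => (hφ.norm_lt_one ζ h).not_ge hζ

lemma eval_revPoly_ne_zero (hφ : IsSchurStable N φ) {ζ : ℂ} (hζ : ‖ζ‖ ≤ 1) :
    (revPoly N φ).eval ζ ≠ 0 := by
  rcases eq_or_ne ζ 0 with rfl | hne
  · rw [eval_zero_revPoly]
    exact (_root_.map_ne_zero _).2 hφ.coeff_ne_zero
  · rw [eval_revPoly hφ.natDegree_eq.le hne]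
    refine mul_ne_zero (pow_ne_zero _ hne) ((_root_.map_ne_zero _).2 (hφ.eval_ne_zero ?_))
    rw [norm_inv, RCLike.norm_conj]
    exact (one_le_inv₀ (norm_pos_iff.2 hne)).2 hζ

lemma isCoprime_revPoly (hφ : IsSchurStable N φ) : IsCoprime φ (revPoly N φ) := by
  rw [isCoprime_iff_aeval_ne_zero_of_isAlgClosed (k := ℂ) ℂ]
  intro a
  simp only [coe_aeval_eq_eval]
  exact or_iff_not_imp_left.2 fun h =>
    hφ.eval_revPoly_ne_zero (hφ.norm_lt_one a (not_not.1 h)).le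

lemma mul {M : ℕ} {ψ : ℂ[X]} (hφ : IsSchurStable N φ) (hψ : IsSchurStable M ψ) :
    IsSchurStable (N + M) (φ * ψ) where
  degree_eq := by rw [degree_mul, hφ.degree_eq, hψ.degree_eq, Nat.cast_add]
  norm_lt_one ζ h := (mul_eq_zero.1 (eval_mul (R := ℂ) ▸ h)).elim
    (hφ.norm_lt_one ζ) (hψ.norm_lt_one ζ)

end IsSchurStable

lemma isSchurStable_X_pow (l : ℕ) : IsSchurStable l (X ^ l) :=
  ⟨degree_X_pow l, fun ζ h => by
    rw [eval_pow, eval_X] at h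
    simp [eq_zero_of_pow_eq_zero h]⟩

end Reversal

section UnitCircle

variable {μ : Measure ℂ} {N : ℕ} {φ : ℂ[X]}

lemma conj_mul_self_of_norm_eq_one {z : ℂ} (hz : ‖z‖ = 1) : conj z * z = 1 := by
  rw [Complex.conj_mul', hz, Complex.ofReal_one, one_pow]

lemma polyInner_congr_of_circle (hc : ∀ᵐ z ∂μ, ‖z‖ = 1) {p q r s : ℂ[X]}
    (h : ∀ z : ℂ, ‖z‖ = 1 → conj (p.eval z) * q.eval z = conj (r.eval z) * s.eval z) :
    polyInner μ p q = polyInner μ r s :=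
  integral_congr_ae (hc.mono fun z hz => h z hz)

lemma polyInner_X_pow_mul_X_pow_mul (hc : ∀ᵐ z ∂μ, ‖z‖ = 1) (k : ℕ) (p q : ℂ[X]) :
    polyInner μ (X ^ k * p) (X ^ k * q) = polyInner μ p q := by
  refine polyInner_congr_of_circle hc fun z hz => ?_
  have hzk : conj (z ^ k) * z ^ k = 1 := conj_mul_self_of_norm_eq_one (by simp [hz])
  simp only [eval_mul, eval_pow, eval_X, map_mul]
  linear_combination conj (p.eval z) * q.eval z * hzk

lemma polyInner_X_mul_X_mul (hc : ∀ᵐ z ∂μ, ‖z‖ = 1) (p q : ℂ[X]) :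
    polyInner μ (X * p) (X * q) = polyInner μ p q := by
  simpa only [pow_one] using polyInner_X_pow_mul_X_pow_mul hc 1 p q

lemma polyInner_revPoly_left (hc : ∀ᵐ z ∂μ, ‖z‖ = 1) {p : ℂ[X]} (hp : p.natDegree ≤ N)
    (q : ℂ[X]) : polyInner μ (revPoly N p) q = polyInner μ (X ^ N) (p * q) := by
  refine polyInner_congr_of_circle hc fun z hz => ?_
  rw [eval_revPoly_of_norm_eq_one hp hz]
  simp only [map_mul, Complex.conj_conj, eval_mul, eval_pow, eval_X]
  ring

lemma polyInner_X_pow_mul_revPoly (hc : ∀ᵐ z ∂μ, ‖z‖ = 1) (hφ : φ.natDegree ≤ N) (q : ℂ[X]) :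
    polyInner μ (X ^ N) (q * revPoly N φ) = polyInner μ φ q := by
  refine polyInner_congr_of_circle hc fun z hz => ?_
  have hzN : conj (z ^ N) * z ^ N = 1 := conj_mul_self_of_norm_eq_one (by simp [hz])
  rw [eval_mul, eval_revPoly_of_norm_eq_one hφ hz, eval_pow, eval_X]
  linear_combination conj (φ.eval z) * q.eval z * hzN

/-- At a zero `a`, write `φ = (X - a) q`. Then `X q = φ + a q` with orthogonal summands, and
`‖X q‖ = ‖q‖`, so `‖q‖² = ‖φ‖² + |a|² ‖q‖²`. -/
lemma OrthogonalBelow.isSchurStable (hc : ∀ᵐ z ∂μ, ‖z‖ = 1) (hμ : PolyIntegrable μ)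
    (hφ : OrthogonalBelow μ N φ) (hdeg : φ.degree = N) (hne : polyInner μ φ φ ≠ 0) :
    IsSchurStable N φ := by
  refine ⟨hdeg, fun a ha => ?_⟩
  obtain ⟨q, hq⟩ := dvd_iff_isRoot.2 ha
  have hqN : q.degree < N := by
    have hq0 : q ≠ 0 := by rintro rfl; simp [hq] at hdeg
    rw [← hdeg, hq, degree_mul, degree_X_sub_C, degree_eq_natDegree hq0]
    exact_mod_cast Nat.lt_one_add_iff.2 (le_refl q.natDegree)
  have hXq : X * q = φ + C a * q := by rw [hq]; ring
  have hpyth : polyInner μ q q = polyInner μ φ φ + conj a * a * polyInner μ q q := by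
    conv_lhs => rw [← polyInner_X_mul_X_mul hc, hXq]
    simp only [polyInner_add_left hμ, polyInner_add_right hμ, polyInner_C_mul_left,
      polyInner_C_mul_right, hφ q hqN, polyInner_eq_zero_symm (hφ q hqN)]
    ring
  rw [polyInner_self] at hne
  rw [polyInner_self, polyInner_self, Complex.conj_mul'] at hpyth
  have hnorm : ∫ z, ‖q.eval z‖ ^ 2 ∂μ = (∫ z, ‖φ.eval z‖ ^ 2 ∂μ)
      + ‖a‖ ^ 2 * ∫ z, ‖q.eval z‖ ^ 2 ∂μ := by exact_mod_cast hpyth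
  have hpos : 0 < ∫ z, ‖φ.eval z‖ ^ 2 ∂μ :=
    (integral_nonneg fun z => by positivity).lt_of_ne' (Complex.ofReal_ne_zero.1 hne)
  have hq0 : 0 ≤ ∫ z, ‖q.eval z‖ ^ 2 ∂μ := integral_nonneg fun z => by positivity
  by_contra! ha1
  nlinarith [one_le_pow₀ ha1 (n := 2)]

lemma exists_mul_add_mul_eq_X_pow {Q R : ℂ[X]} (hQ : Q.degree = N) (hR : R.natDegree ≤ N)
    (h : IsCoprime Q R) :
    ∃ a b : ℂ[X], a * Q + b * R = X ^ N ∧ a.natDegree ≤ N ∧ b.degree < N := by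
  obtain ⟨u, v, huv⟩ := h
  have hQ0 : Q ≠ 0 := ne_zero_of_degree_gt (n := ⊥) (by rw [hQ]; exact WithBot.bot_lt_coe N)
  have hb : (X ^ N * v % Q : ℂ[X]).degree < N :=
    hQ ▸ (EuclideanDomain.mod_lt (X ^ N * v) hQ0 : (X ^ N * v % Q).degree < Q.degree)
  have hab : (X ^ N * u + (X ^ N * v) / Q * R) * Q + (X ^ N * v) % Q * R = X ^ N := by
    linear_combination X ^ N * huv + R * EuclideanDomain.mod_add_div (X ^ N * v) Q
  refine ⟨_, _, hab, ?_, hb⟩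
  generalize X ^ N * u + (X ^ N * v) / Q * R = a at hab ⊢
  generalize (X ^ N * v) % Q = b at hab hb
  rcases eq_or_ne a 0 with rfl | ha
  · simp
  have haQ : (a * Q).natDegree ≤ N + N := by
    rw [eq_sub_of_add_eq hab]
    exact (natDegree_sub_le _ _).trans
      (max_le (by simp) (natDegree_mul_le_of_le (natDegree_le_of_degree_le hb.le) hR))
  rw [natDegree_mul ha hQ0, natDegree_eq_of_degree_eq_some hQ] at haQ
  omega

lemma OrthogonalBelow.polyInner_one_one (hc : ∀ᵐ z ∂μ, ‖z‖ = 1) (hμ : PolyIntegrable μ)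
    (hφ : OrthogonalBelow μ N φ) (hdeg : φ.degree = N) {a b : ℂ[X]}
    (hab : a * φ + b * revPoly N φ = X ^ N) (ha : a.natDegree ≤ N) (hb : b.degree < N) :
    polyInner μ 1 1 = a.coeff 0 / conj (φ.coeff N) * polyInner μ φ φ := by
  have hφN : φ.natDegree ≤ N := (natDegree_eq_of_degree_eq_some hdeg).le
  calc polyInner μ 1 1
      = polyInner μ (X ^ N) (a * φ + b * revPoly N φ) := by
        rw [hab, ← polyInner_X_pow_mul_X_pow_mul hc N, mul_one]
    _ = polyInner μ (revPoly N a) φ + polyInner μ φ b := by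
        rw [polyInner_add_right hμ, ← polyInner_revPoly_left hc ha,
          polyInner_X_pow_mul_revPoly hc hφN]
    _ = conj (polyInner μ φ (revPoly N a)) := by rw [hφ b hb, add_zero, conj_polyInner]
    _ = a.coeff 0 / conj (φ.coeff N) * polyInner μ φ φ := by
        rw [hφ.polyInner_eq hμ hdeg (natDegree_revPoly_le ha), coeff_revPoly_self, map_mul,
          conj_polyInner, map_div₀, Complex.conj_conj]

lemma IsSchurStable.polyInner_one_one_eq {ν : Measure ℂ} (hφ : IsSchurStable N φ)
    (hcμ : ∀ᵐ z ∂μ, ‖z‖ = 1) (hcν : ∀ᵐ z ∂ν, ‖z‖ = 1)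
    (hμ : PolyIntegrable μ) (hν : PolyIntegrable ν)
    (hφμ : OrthogonalBelow μ N φ) (hφν : OrthogonalBelow ν N φ)
    (hnorm : polyInner μ φ φ = polyInner ν φ φ) : polyInner μ 1 1 = polyInner ν 1 1 := by
  obtain ⟨a, b, hab, ha, hb⟩ := exists_mul_add_mul_eq_X_pow hφ.degree_eq
    (natDegree_revPoly_le hφ.natDegree_eq.le) hφ.isCoprime_revPoly
  rw [hφμ.polyInner_one_one hcμ hμ hφ.degree_eq hab ha hb,
    hφν.polyInner_one_one hcν hν hφ.degree_eq hab ha hb, hnorm]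

lemma OrthogonalBelow.polyInner_X_mul_paraorthogonal (hc : ∀ᵐ z ∂μ, ‖z‖ = 1)
    (hμ : PolyIntegrable μ) (hφ : OrthogonalBelow μ N φ) (hφN : φ.natDegree ≤ N) {s : ℂ[X]}
    (hs : s.degree < N) (c : ℂ) : polyInner μ (X * s) (X * φ - C c * revPoly N φ) = 0 := by
  rcases eq_or_ne s 0 with rfl | hs0
  · rw [mul_zero, ← conj_polyInner, polyInner_zero_right, map_zero]
  have hsN : s.natDegree < N := (natDegree_lt_iff_degree_lt hs0).2 hs
  have hsN1 : s.natDegree ≤ N - 1 := Nat.le_sub_one_of_lt hsN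
  have hrev : polyInner μ (X * s) (revPoly N φ) = polyInner μ φ (revPoly (N - 1) s) := by
    refine polyInner_congr_of_circle hc fun z hz => ?_
    rw [eval_revPoly_of_norm_eq_one hφN hz, eval_revPoly_of_norm_eq_one hsN1 hz,
      ← pow_sub_one_mul (by omega : N ≠ 0) z, eval_mul, eval_X, map_mul]
    linear_combination z ^ (N - 1) * conj (s.eval z) * conj (φ.eval z) *
      conj_mul_self_of_norm_eq_one hz
  have hlt : (revPoly (N - 1) s).degree < N :=
    degree_le_natDegree.trans_lt (Nat.cast_lt.2 ((natDegree_revPoly_le hsN1).trans_lt (by omega)))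
  rw [polyInner_sub_right hμ, polyInner_X_mul_X_mul hc, polyInner_eq_zero_symm (hφ s hs),
    polyInner_C_mul_right, hrev, hφ _ hlt, mul_zero, sub_zero]

end UnitCircle

section UniformMeasure

variable {n N : ℕ}

lemma isProbabilityMeasure_uniformMeasure [NeZero n] (x : Fin n → ℂ) :
    IsProbabilityMeasure (uniformMeasure x) :=
  ⟨by simp [uniformMeasure, ENNReal.inv_mul_cancel, NeZero.ne]⟩

lemma ae_uniformMeasure_iff {x : Fin n → ℂ} {P : ℂ → Prop} :
    (∀ᵐ z ∂(uniformMeasure x), P z) ↔ ∀ j, P (x j) := by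
  have hc : (n : ENNReal)⁻¹ ≠ 0 := ENNReal.inv_ne_zero.2 (ENNReal.natCast_ne_top n)
  rw [uniformMeasure, Measure.ae_ennreal_smul_measure_iff hc, ae_finsetSum_measure_iff]
  simp [ae_dirac_eq]

lemma polyIntegrable_uniformMeasure [NeZero n] (x : Fin n → ℂ) :
    PolyIntegrable (uniformMeasure x) := by
  have := isProbabilityMeasure_uniformMeasure x
  exact polyIntegrable_of_ae_norm_le (R := ∑ j, ‖x j‖) <| ae_uniformMeasure_iff.2 fun j =>
    Finset.single_le_sum (fun i _ => norm_nonneg (x i)) (Finset.mem_univ j)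

lemma definiteBelow_uniformMeasure [NeZero n] {x : Fin n → ℂ} (hx : Function.Injective x) :
    DefiniteBelow (uniformMeasure x) n := by
  refine definiteBelow_of_measure_compl_ne_zero (polyIntegrable_uniformMeasure x) fun s hs h => ?_
  have hmem : ∀ j, x j ∈ s := ae_uniformMeasure_iff.1 (ae_iff.2 h)
  have hcard := Fintype.card_le_of_injective (fun j => (⟨x j, hmem j⟩ : s))
    fun i j hij => hx (Subtype.ext_iff.1 hij)
  rw [Fintype.card_fin, Fintype.card_coe] at hcard
  omega

lemma exists_eq_X_mul_of_eval_zero_eq_zero {p : ℂ[X]} (h0 : p.eval 0 = 0)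
    (hdeg : p.degree < (N + 1 : ℕ)) : ∃ s : ℂ[X], p = X * s ∧ s.degree < N := by
  obtain ⟨s, rfl⟩ : X ∣ p := X_dvd_iff.2 (by rw [coeff_zero_eq_eval_zero, h0])
  refine ⟨s, rfl, (degree_lt_iff_coeff_zero s N).2 fun i hi => ?_⟩
  rw [← coeff_X_mul]
  exact (degree_lt_iff_coeff_zero _ _).1 hdeg (i + 1) (by omega)

/-- Both sides agree in degree `N + 1` and at `0`, so they differ by `X s` with `deg s < N`, and
this difference is orthogonal to the left side, which equals it at every node. -/
lemma X_mul_sub_revPoly_eq_nodal {x : Fin (N + 1) → ℂ} (hx : Function.Injective x)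
    (hx1 : ∀ j, ‖x j‖ = 1) {φ : ℂ[X]} (hφ : OrthogonalBelow (uniformMeasure x) N φ)
    (hφN : φ.natDegree ≤ N) (hcoeff : conj (φ.coeff N) = φ.coeff N) :
    X * φ - C (conj (betaOf x)) * revPoly N φ
      = C (φ.coeff N) * Lagrange.nodal Finset.univ x := by
  set P : ℂ[X] := X * φ - C (conj (betaOf x)) * revPoly N φ with hP
  set Q : ℂ[X] := C (φ.coeff N) * Lagrange.nodal Finset.univ x with hQ
  have hrev := natDegree_revPoly_le hφN
  have heval : (P - Q).eval 0 = 0 := by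
    have hβ : conj (betaOf x) = (-1) ^ N * ∏ j, x j := by simp [betaOf, pow_add]
    simp only [hP, hQ, hβ, eval_sub, eval_mul, eval_X, eval_C, eval_zero_revPoly, hcoeff,
      Lagrange.eval_nodal, zero_sub, Finset.prod_neg, Finset.card_univ, Fintype.card_fin]
    ring
  have hdeg : (P - Q).degree < (N + 1 : ℕ) := by
    have hmonic : (Lagrange.nodal Finset.univ x).coeff (N + 1) = 1 := by
      simpa using (Lagrange.nodal_monic (s := Finset.univ) (v := x)).coeff_natDegree
    refine degree_sub_lt_of_coeff_eq ((natDegree_sub_le _ _).trans (max_le ?_ ?_)) ?_ ?_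
    · exact (natDegree_mul_le_of_le natDegree_X_le hφN).trans_eq (add_comm 1 N)
    · exact (natDegree_C_mul_le _ _).trans (hrev.trans N.le_succ)
    · exact (natDegree_C_mul_le _ _).trans (by simp)
    · rw [hP, hQ, coeff_sub, coeff_X_mul, coeff_C_mul, coeff_C_mul, hmonic, mul_one,
        coeff_eq_zero_of_natDegree_lt (hrev.trans_lt N.lt_succ_self), mul_zero, sub_zero]
  obtain ⟨s, hs, hsN⟩ := exists_eq_X_mul_of_eval_zero_eq_zero heval hdeg
  have hPQ : polyInner (uniformMeasure x) (P - Q) (P - Q) = 0 := by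
    have hμ := polyIntegrable_uniformMeasure x
    have hnodal : polyInner (uniformMeasure x) (P - Q) Q = 0 :=
      integral_eq_zero_of_ae <| ae_uniformMeasure_iff.2 fun j => by
        simp [hQ, Lagrange.eval_nodal_at_node]
    rw [polyInner_sub_right hμ, hnodal, hs, sub_zero]
    exact hφ.polyInner_X_mul_paraorthogonal (ae_uniformMeasure_iff.2 hx1) hμ hφN hsN _
  exact sub_eq_zero.1 (definiteBelow_uniformMeasure hx _ hdeg hPQ)

end UniformMeasure

section CircleAverage

open Real (circleAverage)

lemma norm_expI (θ : ℝ) : ‖expI θ‖ = 1 := Complex.norm_exp_ofReal_mul_I θ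

lemma expI_ne_zero (θ : ℝ) : expI θ ≠ 0 := Complex.exp_ne_zero _

lemma expI_eq_circleMap : expI = circleMap 0 1 := by
  ext θ
  simp [expI, circleMap]

lemma hasDerivAt_expI (θ : ℝ) : HasDerivAt expI (Complex.I * expI θ) θ := by
  simpa only [expI_eq_circleMap, mul_comm] using hasDerivAt_circleMap 0 1 θ

lemma continuous_expI : Continuous expI := expI_eq_circleMap ▸ continuous_circleMap 0 1

lemma intervalIntegral_div_two_pi_eq_circleAverage {f : ℝ → ℂ} {F : ℂ → ℂ}
    (hF : ∀ θ, f θ = F (expI θ)) :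
    ∫ θ in (0 : ℝ)..(2 * Real.pi), f θ / (2 * Real.pi) = circleAverage F 0 1 := by
  simp [hF, Real.circleAverage_def, expI_eq_circleMap, div_eq_inv_mul]

lemma circleAverage_conj (F : ℂ → ℂ) (c : ℂ) (R : ℝ) :
    circleAverage (fun ζ => conj (F ζ)) c R = conj (circleAverage F c R) := by
  simp only [Real.circleAverage_def, intervalIntegral.integral_of_le Real.two_pi_pos.le,
    integral_conj, Complex.real_smul, map_mul, Complex.conj_ofReal]

lemma circleIntegrable_eval_div_eval (P : ℂ[X]) {Q : ℂ[X]}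
    (hQ : ∀ ζ : ℂ, ‖ζ‖ = 1 → Q.eval ζ ≠ 0) :
    CircleIntegrable (fun ζ => P.eval ζ / Q.eval ζ) 0 1 :=
  (P.continuous.continuousOn.div Q.continuous.continuousOn fun ζ hζ =>
    hQ ζ (by simpa using hζ)).circleIntegrable zero_le_one

lemma diffContOnCl_eval_div_eval (P : ℂ[X]) {Q : ℂ[X]}
    (hQ : ∀ ζ : ℂ, ‖ζ‖ ≤ 1 → Q.eval ζ ≠ 0) :
    DiffContOnCl ℂ (fun ζ => P.eval ζ / Q.eval ζ) (Metric.ball 0 |1|) := by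
  refine DifferentiableOn.diffContOnCl fun ζ hζ => ?_
  rw [abs_one, closure_ball _ one_ne_zero, mem_closedBall_zero_iff] at hζ
  exact (P.differentiableAt.div Q.differentiableAt (hQ ζ hζ)).differentiableWithinAt

lemma circleAverage_eval_div_eval (P : ℂ[X]) {Q : ℂ[X]}
    (hQ : ∀ ζ : ℂ, ‖ζ‖ ≤ 1 → Q.eval ζ ≠ 0) :
    circleAverage (fun ζ => P.eval ζ / Q.eval ζ) 0 1 = P.eval 0 / Q.eval 0 :=
  (diffContOnCl_eval_div_eval P hQ).circleAverage

variable {N : ℕ} {P Q : ℂ[X]}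

lemma eval_revPoly_div_eval_revPoly (hP : P.natDegree ≤ N) (hQ : Q.natDegree ≤ N) {z : ℂ}
    (hz : z ≠ 0) : (revPoly N P).eval z / (revPoly N Q).eval z
      = conj (P.eval (conj z)⁻¹ / Q.eval (conj z)⁻¹) := by
  rw [eval_revPoly hP hz, eval_revPoly hQ hz, mul_div_mul_left _ _ (pow_ne_zero N hz), map_div₀]

namespace IsSchurStable

/-- Conjugation on the circle replaces `P / Q` by the quotient of the reversed polynomials, which
has no poles in the closed disc. -/
lemma circleAverage_div (hQ : IsSchurStable N Q) (hP : P.natDegree ≤ N) :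
    circleAverage (fun ζ => P.eval ζ / Q.eval ζ) 0 1 = P.coeff N / Q.coeff N := by
  have h := circleAverage_eval_div_eval (revPoly N P) fun ζ hζ => hQ.eval_revPoly_ne_zero hζ
  rw [eval_zero_revPoly, eval_zero_revPoly, ← map_div₀] at h
  rw [← Complex.conj_conj (P.coeff N / Q.coeff N), ← h, ← circleAverage_conj]
  refine Real.circleAverage_congr_sphere fun ζ hζ => ?_
  have hζ1 : ‖ζ‖ = 1 := by simpa using hζ
  have hζ0 : ζ ≠ 0 := norm_ne_zero_iff.1 (by simp [hζ1])
  simp only [eval_revPoly_div_eval_revPoly hP hQ.natDegree_eq.le hζ0, Complex.conj_conj,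
    ← Complex.inv_eq_conj hζ1, inv_inv]

/-- Conjugation on the circle turns this into the Cauchy integral formula at `1 / conj z` for the
quotient of the reversed polynomials. -/
lemma circleAverage_div_div_sub (hQ : IsSchurStable N Q) (hP : P.natDegree ≤ N) {z : ℂ}
    (hz : 1 < ‖z‖) :
    circleAverage (fun ζ => P.eval ζ / Q.eval ζ / (z - ζ)) 0 1 = P.eval z / Q.eval z / z := by
  have hz0 : z ≠ 0 := norm_pos_iff.1 (one_pos.trans hz)
  have hw0 : (conj z)⁻¹ ≠ 0 := inv_ne_zero ((_root_.map_ne_zero _).2 hz0)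
  have hw : (conj z)⁻¹ ∈ Metric.ball (0 : ℂ) |1| := by
    simpa using inv_lt_one_of_one_lt₀ hz
  have hcauchy := (diffContOnCl_eval_div_eval (revPoly N P)
    fun ζ hζ => hQ.eval_revPoly_ne_zero hζ).circleAverage_smul_div hw
  rw [eval_revPoly_div_eval_revPoly hP hQ.natDegree_eq.le hw0, map_inv₀, inv_inv,
    Complex.conj_conj] at hcauchy
  rw [div_eq_inv_mul _ z, ← Complex.conj_conj (P.eval z / Q.eval z), ← hcauchy,
    ← circleAverage_conj, ← smul_eq_mul, ← Real.circleAverage_fun_smul]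
  refine Real.circleAverage_congr_sphere fun ζ hζ => ?_
  have hζ1 : ‖ζ‖ = 1 := by simpa using hζ
  have hζ0 : ζ ≠ 0 := norm_ne_zero_iff.1 (by simp [hζ1])
  have hζz : z - ζ ≠ 0 := sub_ne_zero.2 fun h => by simp [h, hζ1] at hz
  simp only [eval_revPoly_div_eval_revPoly hP hQ.natDegree_eq.le hζ0, smul_eq_mul, sub_zero,
    map_mul, map_div₀, map_sub, map_inv₀, Complex.conj_conj, ← Complex.inv_eq_conj hζ1, inv_inv]
  field_simp

end IsSchurStable

end CircleAverage

section CircleMeasure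

variable {w : ℝ → ℝ}

lemma integral_circleMeasure (hw : Continuous w) (hpos : ∀ θ, 0 ≤ w θ) {f F : ℂ → ℂ}
    (hf : Continuous f) (hF : ∀ θ, f (expI θ) * w θ = F (expI θ)) :
    ∫ z, f z ∂(circleMeasure w) = Real.circleAverage F 0 1 := by
  rw [circleMeasure, integral_map continuous_expI.aemeasurable hf.aestronglyMeasurable,
    integral_withDensity_eq_integral_toReal_smul (by fun_prop) (by simp),
    ← intervalIntegral_div_two_pi_eq_circleAverage hF,
    intervalIntegral.integral_of_le Real.two_pi_pos.le]
  refine integral_congr_ae (.of_forall fun θ => ?_)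
  simp only [ENNReal.toReal_ofReal (div_nonneg (hpos θ) Real.two_pi_pos.le), Complex.real_smul]
  push_cast
  ring

lemma isFiniteMeasure_circleMeasure (hw : Continuous w) : IsFiniteMeasure (circleMeasure w) := by
  have hint : IntegrableOn (fun θ => w θ / (2 * Real.pi)) (Set.Ioc 0 (2 * Real.pi)) :=
    (hw.div_const _).integrableOn_Icc.mono_set Set.Ioc_subset_Icc_self
  have := isFiniteMeasure_withDensity_ofReal hint.2
  exact Measure.isFiniteMeasure_map _ _

lemma ae_circleMeasure_norm_eq_one (w : ℝ → ℝ) : ∀ᵐ z ∂(circleMeasure w), ‖z‖ = 1 := by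
  rw [circleMeasure, ae_map_iff continuous_expI.aemeasurable
    (measurableSet_eq_fun measurable_norm measurable_const)]
  exact .of_forall norm_expI

lemma polyIntegrable_circleMeasure (hw : Continuous w) : PolyIntegrable (circleMeasure w) := by
  have := isFiniteMeasure_circleMeasure hw
  exact polyIntegrable_of_ae_norm_le
    ((ae_circleMeasure_norm_eq_one w).mono fun z hz => hz.le)

lemma circleMeasure_eq_zero_of_countable (w : ℝ → ℝ) {s : Set ℂ} (hs : s.Countable) :
    circleMeasure w s = 0 := by
  have hpre : (expI ⁻¹' s).Countable :=
    expI_eq_circleMap ▸ hs.preimage_circleMap 0 one_ne_zero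
  rw [circleMeasure, Measure.map_apply continuous_expI.measurable hs.measurableSet]
  exact (withDensity_absolutelyContinuous _ _).trans Measure.absolutelyContinuous_restrict
    |>.null_mono (hpre.measure_zero _)

lemma definiteBelow_circleMeasure (hw : Continuous w) (h0 : circleMeasure w ≠ 0) (K : ℕ) :
    DefiniteBelow (circleMeasure w) K := by
  refine definiteBelow_of_measure_compl_ne_zero (polyIntegrable_circleMeasure hw)
    fun s _ hs => h0 ?_
  rw [← Measure.measure_univ_eq_zero, ← Set.union_compl_self (s : Set ℂ), measure_union_null_iff]
  exact ⟨circleMeasure_eq_zero_of_countable w s.countable_toSet, hs⟩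

end CircleMeasure

section BernsteinSzego

/-- The Bernstein–Szegő weight `1 / |φ|²` on the unit circle, as a function of the angle. -/
noncomputable def bernsteinWeight (φ : ℂ[X]) (θ : ℝ) : ℝ :=
  1 / ‖φ.eval (expI θ)‖ ^ 2

variable {N : ℕ} {φ : ℂ[X]}

lemma bernsteinWeight_nonneg (φ : ℂ[X]) (θ : ℝ) : 0 ≤ bernsteinWeight φ θ := by
  unfold bernsteinWeight
  positivity

lemma ofReal_bernsteinWeight (φ : ℂ[X]) (θ : ℝ) : (bernsteinWeight φ θ : ℂ)
    = 1 / (conj (φ.eval (expI θ)) * φ.eval (expI θ)) := by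
  rw [bernsteinWeight, Complex.conj_mul', Complex.ofReal_div, Complex.ofReal_one,
    Complex.ofReal_pow]

namespace IsSchurStable

lemma continuous_bernsteinWeight (hφ : IsSchurStable N φ) : Continuous (bernsteinWeight φ) := by
  refine continuous_const.div ((φ.continuous.comp continuous_expI).norm.pow 2) fun θ => ?_
  exact pow_ne_zero 2 (norm_ne_zero_iff.2 (hφ.eval_ne_zero (norm_expI θ).ge))

lemma polyIntegrable_bernsteinWeight (hφ : IsSchurStable N φ) :
    PolyIntegrable (circleMeasure (bernsteinWeight φ)) :=
  polyIntegrable_circleMeasure hφ.continuous_bernsteinWeight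

/-- On the circle the factor `conj φ` of the weight cancels, which leaves the average of the
rational function `q / (X ^ l * φ)`. -/
lemma polyInner_X_pow_mul_bernsteinWeight (hφ : IsSchurStable N φ) {l : ℕ} {q : ℂ[X]}
    (hq : q.natDegree ≤ l + N) :
    polyInner (circleMeasure (bernsteinWeight φ)) (X ^ l * φ) q
      = q.coeff (l + N) / φ.coeff N := by
  have hψ := (isSchurStable_X_pow l).mul hφ
  rw [← coeff_X_pow_mul φ l N, add_comm N l, ← hψ.circleAverage_div hq]
  refine integral_circleMeasure hφ.continuous_bernsteinWeight (bernsteinWeight_nonneg φ)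
    (by fun_prop) fun θ => ?_
  have hne := hφ.eval_ne_zero (norm_expI θ).ge
  have hconj := (_root_.map_ne_zero (starRingEnd ℂ)).2 hne
  have hpow := pow_ne_zero l (expI_ne_zero θ)
  simp only [ofReal_bernsteinWeight, eval_mul, eval_pow, eval_X, map_mul, map_pow,
    ← Complex.inv_eq_conj (norm_expI θ), inv_pow]
  field_simp

lemma polyInner_self_bernsteinWeight (hφ : IsSchurStable N φ) :
    polyInner (circleMeasure (bernsteinWeight φ)) φ φ = 1 := by
  have h := hφ.polyInner_X_pow_mul_bernsteinWeight (l := 0) (q := φ)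
    (by rw [zero_add, hφ.natDegree_eq])
  rwa [pow_zero, one_mul, zero_add, div_self hφ.coeff_ne_zero] at h

lemma orthogonalBelow_X_pow_mul_bernsteinWeight (hφ : IsSchurStable N φ) (l : ℕ) :
    OrthogonalBelow (circleMeasure (bernsteinWeight φ)) (l + N) (X ^ l * φ) := fun q hq => by
  rw [hφ.polyInner_X_pow_mul_bernsteinWeight (natDegree_le_of_degree_le hq.le),
    coeff_eq_zero_of_degree_lt hq, zero_div]

lemma orthogonalBelow_bernsteinWeight (hφ : IsSchurStable N φ) :
    OrthogonalBelow (circleMeasure (bernsteinWeight φ)) N φ := by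
  simpa using hφ.orthogonalBelow_X_pow_mul_bernsteinWeight 0

lemma definiteBelow_bernsteinWeight (hφ : IsSchurStable N φ) (K : ℕ) :
    DefiniteBelow (circleMeasure (bernsteinWeight φ)) K := by
  refine definiteBelow_circleMeasure hφ.continuous_bernsteinWeight (fun h => ?_) K
  simpa [h, polyInner] using hφ.polyInner_self_bernsteinWeight

lemma orthonormalOP_bernsteinWeight (hφ : IsSchurStable N φ)
    (hcoeff : (‖φ.coeff N‖ : ℂ) = φ.coeff N) :
    orthonormalOP (circleMeasure (bernsteinWeight φ)) N = φ :=
  orthonormalOP_eq_of_orthogonalBelow hφ.polyIntegrable_bernsteinWeight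
    (hφ.definiteBelow_bernsteinWeight N) hφ.orthogonalBelow_bernsteinWeight hφ.degree_eq
    hφ.polyInner_self_bernsteinWeight hcoeff

lemma verblunsky_bernsteinWeight (hφ : IsSchurStable N φ) :
    verblunsky (circleMeasure (bernsteinWeight φ)) N = 0 := by
  have hψ := (isSchurStable_X_pow 1).mul hφ
  have hmonic := monicOP_eq_of_orthogonalBelow hφ.polyIntegrable_bernsteinWeight
    (hφ.definiteBelow_bernsteinWeight _) (hφ.orthogonalBelow_X_pow_mul_bernsteinWeight 1)
    hψ.degree_eq
  rw [verblunsky, add_comm N, hmonic]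
  simp

end IsSchurStable

/-- The polar derivative `N p - X p'` of a polynomial `p` of degree at most `N`, with respect to
the pole `0`. It is the polynomial for which `-z (z ^ (-N) p)' = z ^ (-N) * polarDeriv N p`. -/
noncomputable def polarDeriv (N : ℕ) (p : ℂ[X]) : ℂ[X] :=
  C (N : ℂ) * p - X * derivative p

lemma eval_polarDeriv (N : ℕ) (p : ℂ[X]) (z : ℂ) :
    (polarDeriv N p).eval z = N * p.eval z - z * (derivative p).eval z := by
  simp [polarDeriv]

lemma polarDeriv_C_mul (N : ℕ) (c : ℂ) (p : ℂ[X]) :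
    polarDeriv N (C c * p) = C c * polarDeriv N p := by
  rw [polarDeriv, polarDeriv, derivative_C_mul]
  ring

lemma natDegree_polarDeriv_le {K : ℕ} {p : ℂ[X]} (hp : p.natDegree ≤ K) (N : ℕ) :
    (polarDeriv N p).natDegree ≤ K := by
  have hX : (X * derivative p).natDegree ≤ K :=
    natDegree_le_iff_coeff_eq_zero.2 fun i hi => by
      obtain ⟨i, rfl⟩ := Nat.exists_eq_add_one_of_ne_zero (Nat.ne_zero_of_lt hi)
      rw [coeff_X_mul, coeff_derivative, coeff_eq_zero_of_natDegree_lt (by omega),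
        zero_mul]
  exact (natDegree_sub_le _ _).trans (max_le ((natDegree_C_mul_le _ _).trans hp) hX)

lemma hasDerivAt_expI_pow_div_eval (N : ℕ) {p : ℂ[X]} {θ : ℝ} (hp : p.eval (expI θ) ≠ 0) :
    HasDerivAt (fun t => expI t ^ N / p.eval (expI t))
      (Complex.I * expI θ ^ N * (polarDeriv N p).eval (expI θ) / p.eval (expI θ) ^ 2) θ := by
  have hpow := (hasDerivAt_expI θ).fun_pow N
  have heval := (p.hasDerivAt (expI θ)).comp θ (hasDerivAt_expI θ)
  have hN : (N : ℂ) * expI θ ^ (N - 1) * expI θ = N * expI θ ^ N := by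
    rcases N with _ | N
    · simp
    · rw [Nat.add_sub_cancel, mul_assoc, pow_succ]
  refine (hpow.fun_div heval hp).congr_deriv ?_
  rw [eval_polarDeriv, Function.comp_apply]
  congr 1
  linear_combination Complex.I * p.eval (expI θ) * hN

lemma IsSchurStable.ofReal_deriv_bernsteinWeight (hφ : IsSchurStable N φ) (θ : ℝ) :
    ((deriv (bernsteinWeight φ) θ : ℝ) : ℂ) = Complex.I * expI θ ^ N *
      (polarDeriv N (φ * revPoly N φ)).eval (expI θ) / (φ * revPoly N φ).eval (expI θ) ^ 2 := by
  have hweight : (fun t => (bernsteinWeight φ t : ℂ))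
      = fun t => expI t ^ N / (φ * revPoly N φ).eval (expI t) := by
    ext t
    rw [ofReal_bernsteinWeight, eval_mul,
      eval_revPoly_of_norm_eq_one hφ.natDegree_eq.le (norm_expI t), mul_left_comm,
      div_mul_cancel_left₀ (pow_ne_zero N (expI_ne_zero t)), one_div, mul_comm]
  have hne : (φ * revPoly N φ).eval (expI θ) ≠ 0 := by
    rw [eval_mul]
    exact mul_ne_zero (hφ.eval_ne_zero (norm_expI θ).ge)
      (hφ.eval_revPoly_ne_zero (norm_expI θ).le)
  have hderiv := hweight ▸ hasDerivAt_expI_pow_div_eval N hne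
  have hreal : HasDerivAt (bernsteinWeight φ) _ θ :=
    Complex.reCLM.hasFDerivAt.comp_hasDerivAt θ hderiv
  rw [hreal.deriv]
  exact hreal.ofReal_comp.unique hderiv

end BernsteinSzego

section FieldFunctions

variable {N : ℕ} {φ : ℂ[X]} {z : ℂ}

lemma eval_polarDeriv_mul (N : ℕ) (p q : ℂ[X]) (z : ℂ) : (polarDeriv N (p * q)).eval z
    = (polarDeriv N p).eval z * q.eval z - z * p.eval z * (derivative q).eval z := by
  simp only [eval_polarDeriv, derivative_mul, eval_add, eval_mul]
  ring

lemma norm_sq_eval_revPoly (hφ : φ.natDegree ≤ N) {ζ : ℂ} (hζ : ‖ζ‖ = 1) :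
    ((‖(revPoly N φ).eval ζ‖ ^ 2 : ℝ) : ℂ) = φ.eval ζ * (revPoly N φ).eval ζ / ζ ^ N := by
  have hζ0 : ζ ≠ 0 := norm_ne_zero_iff.1 (by simp [hζ])
  rw [eval_revPoly_of_norm_eq_one hφ hζ, norm_mul, norm_pow, hζ, one_pow, one_mul,
    Complex.norm_conj, Complex.ofReal_pow, ← Complex.conj_mul']
  field_simp

lemma sub_ne_zero_of_norm_lt {z ζ : ℂ} (h : ‖ζ‖ < ‖z‖) : z - ζ ≠ 0 :=
  sub_ne_zero.2 fun h' => (h' ▸ h).false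

namespace IsSchurStable

lemma circleAverage_polarDeriv_div_sub (hφ : IsSchurStable N φ) (hz : 1 < ‖z‖) :
    Real.circleAverage (fun ζ => (polarDeriv N φ).eval ζ / φ.eval ζ / (z - ζ)
        - (X * derivative (revPoly N φ)).eval ζ / (revPoly N φ * (C z - X)).eval ζ) 0 1
      = (polarDeriv N φ).eval z / φ.eval z / z := by
  have hden {p : ℂ[X]} {ζ : ℂ} (hp : p.eval ζ ≠ 0) (hζ : ‖ζ‖ ≤ 1) :
      (p * (C z - X)).eval ζ ≠ 0 := by
    simpa using ⟨hp, sub_ne_zero_of_norm_lt (hζ.trans_lt hz)⟩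
  have hinner (ζ : ℂ) (hζ : ‖ζ‖ ≤ 1) : (revPoly N φ * (C z - X)).eval ζ ≠ 0 :=
    hden (hφ.eval_revPoly_ne_zero hζ) hζ
  have houter (ζ : ℂ) (hζ : ‖ζ‖ = 1) : (φ * (C z - X)).eval ζ ≠ 0 :=
    hden (hφ.eval_ne_zero hζ.ge) hζ.le
  have hint : CircleIntegrable (fun ζ => (polarDeriv N φ).eval ζ / φ.eval ζ / (z - ζ)) 0 1 := by
    simpa only [eval_mul, eval_sub, eval_C, eval_X, div_div] using
      circleIntegrable_eval_div_eval (polarDeriv N φ) houter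
  rw [Real.circleAverage_fun_sub hint
      (circleIntegrable_eval_div_eval _ fun ζ hζ => hinner ζ hζ.le),
    hφ.circleAverage_div_div_sub (natDegree_polarDeriv_le hφ.natDegree_eq.le N) hz,
    circleAverage_eval_div_eval _ hinner, eval_mul, eval_X, zero_mul, zero_div, sub_zero]

lemma Gfun_bernsteinWeight (hφ : IsSchurStable N φ)
    (hop : orthonormalOP (circleMeasure (bernsteinWeight φ)) N = φ) (hz : 1 < ‖z‖) :
    Gfun (bernsteinWeight φ) (N + 1) z = -((polarDeriv N φ).eval z / φ.eval z / z) := by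
  have havg := congrArg (Complex.I • ·) (hφ.circleAverage_polarDeriv_div_sub hz)
  simp only [← Real.circleAverage_fun_smul] at havg
  rw [Gfun, Nat.add_sub_cancel, hop, intervalIntegral_div_two_pi_eq_circleAverage fun θ => ?_,
    havg, smul_eq_mul, ← mul_assoc, Complex.I_mul_I, neg_one_mul]
  have hne := hφ.eval_ne_zero (norm_expI θ).ge
  have hne' := hφ.eval_revPoly_ne_zero (norm_expI θ).le
  have hexp := expI_ne_zero θ
  have hsub : z - expI θ ≠ 0 := sub_ne_zero_of_norm_lt (norm_expI θ ▸ hz)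
  simp only [norm_sq_eval_revPoly hφ.natDegree_eq.le (norm_expI θ),
    hφ.ofReal_deriv_bernsteinWeight, eval_polarDeriv_mul, eval_mul, eval_sub, eval_C, eval_X,
    smul_eq_mul]
  field_simp

lemma Dfun_bernsteinWeight (hφ : IsSchurStable N φ)
    (hop : orthonormalOP (circleMeasure (bernsteinWeight φ)) N = φ) (hz : 1 < ‖z‖) :
    Dfun (bernsteinWeight φ) (N + 1) z
      = (polarDeriv N (φ * revPoly N φ)).eval z / (z * φ.eval z ^ 2) := by
  have hz0 : z ≠ 0 := norm_pos_iff.1 (one_pos.trans hz)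
  have hψ : IsSchurStable (1 + (N + N)) (X ^ 1 * (φ * φ)) :=
    (isSchurStable_X_pow 1).mul (hφ.mul hφ)
  have hdeg : (polarDeriv N (φ * revPoly N φ)).natDegree ≤ 1 + (N + N) :=
    (natDegree_polarDeriv_le (natDegree_mul_le_of_le hφ.natDegree_eq.le
      (natDegree_revPoly_le hφ.natDegree_eq.le)) N).trans (by omega)
  have havg := hψ.circleAverage_div_div_sub (P := C Complex.I * polarDeriv N (φ * revPoly N φ))
    ((natDegree_C_mul_le _ _).trans hdeg) hz
  rw [Dfun, Nat.add_sub_cancel, hop, intervalIntegral_div_two_pi_eq_circleAverage fun θ => ?_,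
    havg]
  · simp only [eval_mul, eval_C, eval_pow, eval_X]
    field_simp
    rw [Complex.I_sq, neg_one_mul, neg_div, neg_neg]
  · have hne := hφ.eval_ne_zero (norm_expI θ).ge
    have hne' := hφ.eval_revPoly_ne_zero (norm_expI θ).le
    have hexp := expI_ne_zero θ
    have hsub : z - expI θ ≠ 0 := sub_ne_zero_of_norm_lt (norm_expI θ ▸ hz)
    simp only [hφ.ofReal_deriv_bernsteinWeight, eval_mul, eval_C, eval_pow, eval_X]
    field_simp
    ring

lemma Jfun_bernsteinWeight (hφ : IsSchurStable N φ)
    (hop : orthonormalOP (circleMeasure (bernsteinWeight φ)) N = φ) (hz : 1 < ‖z‖) :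
    Jfun (bernsteinWeight φ) (N + 1) z = 0 := by
  have hden (ζ : ℂ) (hζ : ‖ζ‖ ≤ 1) : (revPoly N φ ^ 2 * (C z - X)).eval ζ ≠ 0 := by
    simpa using ⟨hφ.eval_revPoly_ne_zero hζ, sub_ne_zero_of_norm_lt (hζ.trans_lt hz)⟩
  have havg := circleAverage_eval_div_eval
    (C Complex.I * (X * polarDeriv N (φ * revPoly N φ))) hden
  rw [Jfun, Nat.add_sub_cancel, hop, intervalIntegral_div_two_pi_eq_circleAverage fun θ => ?_,
    havg]
  · simp
  · have hne := hφ.eval_ne_zero (norm_expI θ).ge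
    have hne' := hφ.eval_revPoly_ne_zero (norm_expI θ).le
    have hexp := expI_ne_zero θ
    have hsub := sub_ne_zero_of_norm_lt (norm_expI θ ▸ hz)
    have hpow : expI θ ^ (((N + 1 : ℕ) : ℤ) - 2) = expI θ ^ N / expI θ := by
      rw [div_eq_mul_inv, ← zpow_natCast, ← zpow_sub_one₀ hexp]
      congr 1
      push_cast
      ring
    simp only [hφ.ofReal_deriv_bernsteinWeight, hpow, eval_mul, eval_C, eval_pow, eval_X, eval_sub]
    field_simp

/-- This is `h_n = b z ^ N φ⁻² (z ^ (-N) φ P)'` with `b = conj β` and `P = z φ - b φ^*`. -/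
lemma hfun_bernsteinWeight (hφ : IsSchurStable N φ)
    (hop : orthonormalOP (circleMeasure (bernsteinWeight φ)) N = φ) (β : ℂ) (hz : 1 < ‖z‖) :
    hfun (bernsteinWeight φ) (N + 1) z β β * (X * φ ^ 2).eval z
      = -conj β * (polarDeriv N (φ * (X * φ - C (conj β) * revPoly N φ))).eval z := by
  have hz0 : z ≠ 0 := norm_pos_iff.1 (one_pos.trans hz)
  have hφz : φ.eval z ≠ 0 := hφ.eval_ne_zero hz.le
  rw [hfun, hφ.Gfun_bernsteinWeight hop hz, hφ.Dfun_bernsteinWeight hop hz,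
    hφ.Jfun_bernsteinWeight hop hz, Nat.add_sub_cancel, hφ.verblunsky_bernsteinWeight]
  simp only [eval_polarDeriv, derivative_mul, derivative_sub, derivative_X, derivative_C, eval_mul,
    eval_add, eval_sub, eval_pow, eval_X, eval_C, eval_one, eval_zero]
  push_cast
  field_simp
  ring

end IsSchurStable

end FieldFunctions

section LogarithmicDerivative

variable {K : Type*} [Field K] {p q : K[X]} {z : K}

lemma eval_derivative_mul_div_eval_mul (hp : p.eval z ≠ 0) (hq : q.eval z ≠ 0) :
    (derivative (p * q)).eval z / (p * q).eval z
      = (derivative p).eval z / p.eval z + (derivative q).eval z / q.eval z := by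
  rw [derivative_mul, eval_add, eval_mul, eval_mul, eval_mul, div_add_div _ _ hp hq]

lemma eval_derivative_nodal_div_eval_nodal {ι : Type*} {s : Finset ι} {y : ι → K}
    (hz : ∀ k ∈ s, z ≠ y k) :
    (derivative (Lagrange.nodal s y)).eval z / (Lagrange.nodal s y).eval z
      = ∑ k ∈ s, 1 / (z - y k) := by
  classical
  rw [Lagrange.derivative_nodal, eval_finsetSum, Finset.sum_div]
  refine Finset.sum_congr rfl fun k hk => ?_
  have hne : (Lagrange.nodal (s.erase k) y).eval z ≠ 0 :=
    Lagrange.eval_nodal_not_at_node fun i hi => hz i (Finset.mem_of_mem_erase hi)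
  rw [Lagrange.nodal_eq_mul_nodal_erase hk, eval_mul, eval_sub, eval_X, eval_C,
    div_mul_cancel_right₀ hne, one_div]

lemma eval_derivative_nodal_ne_zero {ι : Type*} [DecidableEq ι] {s : Finset ι} {y : ι → K} {j : ι}
    (hj : j ∈ s) (hy : ∀ k ∈ s.erase j, y j ≠ y k) :
    (derivative (Lagrange.nodal s y)).eval (y j) ≠ 0 := by
  rw [Lagrange.eval_nodal_derivative_eval_node_eq hj]
  exact Lagrange.eval_nodal_not_at_node hy

lemma eval_derivative_derivative_nodal_div {ι : Type*} [DecidableEq ι] {s : Finset ι} {y : ι → K}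
    {j : ι} (hj : j ∈ s) (hy : ∀ k ∈ s.erase j, y j ≠ y k) :
    (derivative (derivative (Lagrange.nodal s y))).eval (y j)
        / (derivative (Lagrange.nodal s y)).eval (y j)
      = 2 * ∑ k ∈ s.erase j, 1 / (y j - y k) := by
  rw [← eval_derivative_nodal_div_eval_nodal hy, ← mul_div_assoc,
    Lagrange.eval_nodal_derivative_eval_node_eq hj, Lagrange.nodal_eq_mul_nodal_erase hj]
  congr 1
  simp only [derivative_mul, derivative_add, derivative_X_sub_C, derivative_one, eval_add, eval_mul,
    eval_sub, eval_X, eval_C, eval_one, eval_zero]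
  ring

lemma sum_rootMultiplicity_div [IsAlgClosed K] {S : K[X]} (hz : S.eval z ≠ 0) [DecidableEq K]
    {T : Finset K} (hT : S.roots.toFinset ⊆ T) :
    ∑ a ∈ T, (S.rootMultiplicity a : K) / (z - a) = (derivative S).eval z / S.eval z := by
  rw [(IsAlgClosed.splits S).eval_derivative_div_eval_of_ne_zero hz,
    Finset.sum_multiset_map_count]
  refine (Finset.sum_subset hT fun a _ ha => ?_).symm.trans ?_
  · rw [← count_roots, Multiset.count_eq_zero.2 (mt Multiset.mem_toFinset.2 ha), Nat.cast_zero,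
      zero_div]
  · simp only [count_roots, nsmul_eq_mul, mul_one_div]

end LogarithmicDerivative

section Equilibrium

variable {N : ℕ} {φ P S₁ S₂ : ℂ[X]} {c z : ℂ}

lemma eval_polarDeriv_mul_of_eval_eq_zero (hP : P.eval z = 0) :
    (polarDeriv N (φ * P)).eval z = -(z * φ.eval z * (derivative P).eval z) := by
  rw [eval_polarDeriv_mul, hP, mul_zero, zero_sub]

lemma eval_derivative_polarDeriv_mul_div (hz : z ≠ 0) (hφ : φ.eval z ≠ 0) (hP : P.eval z = 0)
    (hP' : (derivative P).eval z ≠ 0) :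
    (derivative (polarDeriv N (φ * P))).eval z / (polarDeriv N (φ * P)).eval z
      = (derivative (derivative P)).eval z / (derivative P).eval z
        + 2 * ((derivative φ).eval z / φ.eval z) + (1 - N) / z := by
  rw [eval_polarDeriv_mul_of_eval_eq_zero hP, polarDeriv]
  simp only [derivative_sub, derivative_mul, derivative_add, derivative_C, derivative_X,
    eval_add, eval_sub, eval_mul, eval_C, eval_X, eval_zero, zero_mul, one_mul,
    hP]
  field_simp
  ring

lemma eval_ne_zero_of_mul_eq_mul_polarDeriv (hc : c ≠ 0) (hz : z ≠ 0) (hφ : φ.eval z ≠ 0)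
    (hP : P.eval z = 0) (hP' : (derivative P).eval z ≠ 0)
    (hS : S₁ * (X * φ ^ 2) = S₂ * (C c * polarDeriv N (φ * P)))
    (hcop : ¬ (S₁.eval z = 0 ∧ S₂.eval z = 0)) : S₁.eval z ≠ 0 ∧ S₂.eval z ≠ 0 := by
  have heval := congrArg (eval z) hS
  simp only [eval_mul, eval_X, eval_pow, eval_C, eval_polarDeriv_mul_of_eval_eq_zero hP] at heval
  have hiff : S₁.eval z = 0 ↔ S₂.eval z = 0 := by
    constructor <;> intro h <;> simpa [h, hc, hz, hφ, hP'] using heval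
  tauto

/-- Take logarithmic derivatives in `hS` at `z`. -/
lemma eval_derivative_div_add_eq_zero (hc : c ≠ 0) (hz : z ≠ 0) (hφ : φ.eval z ≠ 0)
    (hP : P.eval z = 0) (hP' : (derivative P).eval z ≠ 0)
    (hS : S₁ * (X * φ ^ 2) = S₂ * (C c * polarDeriv N (φ * P)))
    (hS₁ : S₁.eval z ≠ 0) (hS₂ : S₂.eval z ≠ 0) :
    (derivative (derivative P)).eval z / (derivative P).eval z
      + ((derivative S₂).eval z / S₂.eval z - (derivative S₁).eval z / S₁.eval z)
      - N / z = 0 := by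
  have hX : (X : ℂ[X]).eval z ≠ 0 := by simpa using hz
  have hφ2 : (φ * φ).eval z ≠ 0 := by simpa using hφ
  have hXφ : (X * (φ * φ)).eval z ≠ 0 := by simpa using ⟨hz, hφ⟩
  have hC : (C c).eval z ≠ 0 := by simpa using hc
  have hA : (polarDeriv N (φ * P)).eval z ≠ 0 := by
    rw [eval_polarDeriv_mul_of_eval_eq_zero hP]
    exact neg_ne_zero.2 (mul_ne_zero (mul_ne_zero hz hφ) hP')
  have hCA : (C c * polarDeriv N (φ * P)).eval z ≠ 0 := by simpa using ⟨hc, hA⟩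
  have hlog := congrArg (fun p : ℂ[X] => (derivative p).eval z / p.eval z) hS
  simp only [sq] at hlog
  rw [eval_derivative_mul_div_eval_mul hS₁ hXφ, eval_derivative_mul_div_eval_mul hX hφ2,
    eval_derivative_mul_div_eval_mul hφ hφ, eval_derivative_mul_div_eval_mul hS₂ hCA,
    eval_derivative_mul_div_eval_mul hC hA, eval_derivative_polarDeriv_mul_div hz hφ hP hP',
    derivative_X, derivative_C, eval_one, eval_zero, eval_X, zero_div] at hlog
  linear_combination -hlog

lemma notMem_genPoints (hz : z ≠ 0) (hS₁ : S₁.eval z ≠ 0) (hS₂ : S₂.eval z ≠ 0) :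
    z ∉ genPoints S₁ S₂ := by
  simp [genPoints, hz, hS₁, hS₂]

lemma sum_genCharge (n : ℕ) (hS₁ : S₁.eval z ≠ 0) (hS₂ : S₂.eval z ≠ 0) :
    ∑ a : genPoints S₁ S₂, (genCharge n S₁ S₂ a : ℂ) / (z - a)
      = 1 / 2 * ((derivative S₂).eval z / S₂.eval z - (derivative S₁).eval z / S₁.eval z)
        + (1 - n) / 2 / z := by
  have horigin : ∑ a ∈ genPoints S₁ S₂, (if a = 0 then (1 - (n : ℂ)) / 2 / z else 0)
      = (1 - n) / 2 / z := by
    rw [Finset.sum_ite_eq', if_pos (show 0 ∈ genPoints S₁ S₂ from Finset.mem_insert_self _ _)]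
  rw [Finset.sum_coe_sort (genPoints S₁ S₂) (fun a => (genCharge n S₁ S₂ a : ℂ) / (z - a)),
    ← sum_rootMultiplicity_div hS₁ (T := genPoints S₁ S₂)
      (Finset.subset_union_left.trans (Finset.subset_insert _ _)),
    ← sum_rootMultiplicity_div hS₂ (T := genPoints S₁ S₂)
      (Finset.subset_union_right.trans (Finset.subset_insert _ _)),
    ← horigin, ← Finset.sum_sub_distrib, Finset.mul_sum, ← Finset.sum_add_distrib]
  refine Finset.sum_congr rfl fun a _ => ?_
  unfold genCharge
  split_ifs with ha
  · subst ha
    push_cast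
    ring
  · push_cast
    ring

lemma TotalEquilibrium.exists_fin {n : ℕ} {ι : Type*} [Fintype ι] {x : Fin n → ℂ} {a : ι → ℂ}
    {q : ι → ℝ} (h : TotalEquilibrium x a q) (ha : Function.Injective a)
    (hax : ∀ i j, a i ≠ x j) :
    ∃ (m : ℕ) (a' : Fin m → ℂ) (q' : Fin m → ℝ), Function.Injective a' ∧
      (∀ i j, a' i ≠ x j) ∧ TotalEquilibrium x a' q' := by
  let e := (Fintype.equivFin ι).symm
  refine ⟨_, a ∘ e, q ∘ e, ha.comp e.injective, fun i => hax (e i), fun j => ?_⟩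
  rw [← h j]
  exact congrArg _ (e.sum_comp fun i => (q i : ℂ) / (x j - a i))

end Equilibrium

section Represents

variable {A B S₁ S₂ : ℂ[X]} {h : ℂ → ℂ}

lemma infinite_setOf_one_lt_norm : {z : ℂ | 1 < ‖z‖}.Infinite := by
  refine ((Set.Ioi_infinite (1 : ℝ)).image Complex.ofReal_injective.injOn).mono ?_
  rintro _ ⟨t, ht : 1 < t, rfl⟩
  simpa [abs_of_pos (one_pos.trans ht)] using ht

lemma Represents.mul_eq_mul (hS : Represents S₁ S₂ h)
    (hAB : ∀ z : ℂ, 1 < ‖z‖ → h z * B.eval z = A.eval z) : S₁ * B = S₂ * A := by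
  refine eq_of_infinite_eval_eq _ _ (infinite_setOf_one_lt_norm.mono fun z hz => ?_)
  rw [Set.mem_ofPred_eq, eval_mul, eval_mul, ← hS.2 z hz, ← hAB z hz]
  ring

lemma exists_isCoprime_represents (hB : ∀ z : ℂ, 1 < ‖z‖ → B.eval z ≠ 0)
    (hAB : ∀ z : ℂ, 1 < ‖z‖ → h z * B.eval z = A.eval z) :
    ∃ S₁ S₂ : ℂ[X], IsCoprime S₁ S₂ ∧ Represents S₁ S₂ h := by
  have hB0 : B ≠ 0 := fun h0 => hB 2 (by norm_num) (by rw [h0, eval_zero])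
  obtain ⟨S₁, S₂, d, hrel, rfl, rfl⟩ := UniqueFactorizationMonoid.exists_reduced_factors' A B hB0
  refine ⟨S₁, S₂, hrel.isCoprime, right_ne_zero_of_mul hB0, fun z hz => ?_⟩
  have hd : d.eval z ≠ 0 := left_ne_zero_of_mul (eval_mul (R := ℂ) ▸ hB z hz)
  have hz := hAB z hz
  rw [eval_mul, eval_mul, mul_left_comm] at hz
  exact mul_left_cancel₀ hd hz

end Represents

section Points

variable {N : ℕ} {x : Fin (N + 1) → ℂ}

lemma isSchurStable_orthonormalOP_uniformMeasure (hx : Function.Injective x)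
    (hx1 : ∀ j, ‖x j‖ = 1) : IsSchurStable N (orthonormalOP (uniformMeasure x) N) := by
  have hμ := polyIntegrable_uniformMeasure x
  have hd := definiteBelow_uniformMeasure hx
  refine (orthogonalBelow_orthonormalOP hμ (hd.mono N.le_succ)).isSchurStable
    (ae_uniformMeasure_iff.2 hx1) hμ (degree_orthonormalOP hd) ?_
  rw [polyInner_orthonormalOP_self hd]
  exact one_ne_zero

lemma isProbabilityMeasure_circleMeasure_bsWeight (hx : Function.Injective x)
    (hx1 : ∀ j, ‖x j‖ = 1) : IsProbabilityMeasure (circleMeasure (bsWeight x)) := by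
  have hμ := polyIntegrable_uniformMeasure x
  have hd := definiteBelow_uniformMeasure hx
  have hφ := isSchurStable_orthonormalOP_uniformMeasure hx hx1
  have := isProbabilityMeasure_uniformMeasure x
  have hmass := hφ.polyInner_one_one_eq (ae_uniformMeasure_iff.2 hx1)
    (ae_circleMeasure_norm_eq_one _) hμ hφ.polyIntegrable_bernsteinWeight
    (orthogonalBelow_orthonormalOP hμ (hd.mono N.le_succ)) hφ.orthogonalBelow_bernsteinWeight
    ((polyInner_orthonormalOP_self hd).trans hφ.polyInner_self_bernsteinWeight.symm)
  rw [polyInner_one_one, polyInner_one_one, probReal_univ, Complex.ofReal_inj] at hmass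
  exact ⟨(ENNReal.toReal_eq_one_iff _).1 hmass.symm⟩

lemma exists_hfun_bsWeight_mul_eq (hx : Function.Injective x) (hx1 : ∀ j, ‖x j‖ = 1) :
    ∃ c : ℂ, c ≠ 0 ∧ ∀ z : ℂ, 1 < ‖z‖ →
      hfun (bsWeight x) (N + 1) z (betaOf x) (betaOf x)
          * (X * orthonormalOP (uniformMeasure x) N ^ 2).eval z
        = (C c * polarDeriv N
          (orthonormalOP (uniformMeasure x) N * Lagrange.nodal Finset.univ x)).eval z := by
  set φ := orthonormalOP (uniformMeasure x) N
  have hφ : IsSchurStable N φ := isSchurStable_orthonormalOP_uniformMeasure hx hx1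
  have hcoeff : (‖φ.coeff N‖ : ℂ) = φ.coeff N := norm_coeff_orthonormalOP _ N
  have hβ : conj (betaOf x) ≠ 0 := norm_ne_zero_iff.1 (by simp [betaOf, hx1])
  have hnodal := X_mul_sub_revPoly_eq_nodal hx hx1
    (orthogonalBelow_orthonormalOP (polyIntegrable_uniformMeasure x)
      ((definiteBelow_uniformMeasure hx).mono N.le_succ)) hφ.natDegree_eq.le
    (by rw [← hcoeff, Complex.conj_ofReal])
  refine ⟨-conj (betaOf x) * φ.coeff N, mul_ne_zero (neg_ne_zero.2 hβ) hφ.coeff_ne_zero,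
    fun z hz => (hφ.hfun_bernsteinWeight (hφ.orthonormalOP_bernsteinWeight hcoeff) _ hz).trans ?_⟩
  rw [hnodal, mul_left_comm, polarDeriv_C_mul, eval_C_mul, eval_C_mul, mul_assoc]

lemma exists_isCoprime_represents_hfun_bsWeight (hx : Function.Injective x)
    (hx1 : ∀ j, ‖x j‖ = 1) : ∃ S₁ S₂ : ℂ[X], IsCoprime S₁ S₂ ∧
      Represents S₁ S₂ (fun z => hfun (bsWeight x) (N + 1) z (betaOf x) (betaOf x)) := by
  obtain ⟨c, -, hh⟩ := exists_hfun_bsWeight_mul_eq hx hx1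
  have hφ := isSchurStable_orthonormalOP_uniformMeasure hx hx1
  refine exists_isCoprime_represents (fun z hz => ?_) hh
  simpa using ⟨norm_pos_iff.1 (one_pos.trans hz), hφ.eval_ne_zero hz.le⟩

lemma totalEquilibrium_of_represents_hfun_bsWeight (hx : Function.Injective x)
    (hx1 : ∀ j, ‖x j‖ = 1) {S₁ S₂ : ℂ[X]} (hcop : ∀ j, ¬ (S₁.eval (x j) = 0 ∧ S₂.eval (x j) = 0))
    (hS : Represents S₁ S₂ (fun z => hfun (bsWeight x) (N + 1) z (betaOf x) (betaOf x))) :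
    (∀ j, x j ∉ genPoints S₁ S₂) ∧
      TotalEquilibrium x (fun a : genPoints S₁ S₂ => (a : ℂ))
        (fun a : genPoints S₁ S₂ => genCharge (N + 1) S₁ S₂ a) := by
  obtain ⟨c, hc, hh⟩ := exists_hfun_bsWeight_mul_eq hx hx1
  have hmul := hS.mul_eq_mul hh
  have hx0 (j) : x j ≠ 0 := norm_ne_zero_iff.1 (by simp [hx1])
  have hφ (j) := (isSchurStable_orthonormalOP_uniformMeasure hx hx1).eval_ne_zero (hx1 j).ge
  have hnode (j) := Lagrange.eval_nodal_at_node (v := x) (Finset.mem_univ j)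
  have hdistinct (j) : ∀ k ∈ Finset.univ.erase j, x j ≠ x k := fun k hk =>
    hx.ne (Finset.ne_of_mem_erase hk).symm
  have hsimple (j) := eval_derivative_nodal_ne_zero (Finset.mem_univ j) (hdistinct j)
  have hne (j) := eval_ne_zero_of_mul_eq_mul_polarDeriv hc (hx0 j) (hφ j) (hnode j) (hsimple j)
    hmul (hcop j)
  refine ⟨fun j => notMem_genPoints (hx0 j) (hne j).1 (hne j).2, fun j => ?_⟩
  have hlog := eval_derivative_div_add_eq_zero hc (hx0 j) (hφ j) (hnode j) (hsimple j) hmul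
    (hne j).1 (hne j).2
  rw [eval_derivative_derivative_nodal_div (Finset.mem_univ j) (hdistinct j)] at hlog
  rw [sum_genCharge (N + 1) (hne j).1 (hne j).2]
  push_cast
  linear_combination (1 / 2) * hlog

end Points

end CircleElectro

open CircleElectro Polynomial MeasureTheory in
theorem mainTheorem5 (n : ℕ) (hn : 2 ≤ n) (x : Fin n → ℂ) (hx : Function.Injective x)
    (hx1 : ∀ j, ‖x j‖ = 1) :
    -- existence of a set of electric field generators
    (∃ (m : ℕ) (a : Fin m → ℂ) (q : Fin m → ℝ), Function.Injective a ∧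
        (∀ i j, a i ≠ x j) ∧ TotalEquilibrium x a q) ∧
    -- the explicit construction: the Bernstein–Szegő measure is a probability measure,
    IsProbabilityMeasure (circleMeasure (bsWeight x)) ∧
    -- its function `h_n(z; β; β)` is, for `|z| > 1`, a rational function `S₁ / S₂`,
    (∃ S₁ S₂ : ℂ[X], IsCoprime S₁ S₂ ∧
        Represents S₁ S₂ (fun z => hfun (bsWeight x) n z (betaOf x) (betaOf x))) ∧
    -- and every such quotient without common zeros at the `x_j` yields generators.
    (∀ S₁ S₂ : ℂ[X], (∀ j, ¬ (S₁.eval (x j) = 0 ∧ S₂.eval (x j) = 0)) →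
        Represents S₁ S₂ (fun z => hfun (bsWeight x) n z (betaOf x) (betaOf x)) →
        (∀ j, x j ∉ genPoints S₁ S₂) ∧
        TotalEquilibrium x (fun a : genPoints S₁ S₂ => (a : ℂ))
          (fun a : genPoints S₁ S₂ => genCharge n S₁ S₂ a)) := by
  obtain ⟨N, rfl⟩ : ∃ N, n = N + 1 := ⟨n - 1, by omega⟩
  have hexists := exists_isCoprime_represents_hfun_bsWeight hx hx1
  refine ⟨?_, isProbabilityMeasure_circleMeasure_bsWeight hx hx1, hexists,
    fun _ _ hcop hS => totalEquilibrium_of_represents_hfun_bsWeight hx hx1 hcop hS⟩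
  obtain ⟨S₁, S₂, hcoprime, hS⟩ := hexists
  obtain ⟨hnotMem, hequilibrium⟩ := totalEquilibrium_of_represents_hfun_bsWeight hx hx1
    (fun j => not_and_or.2 (aeval_ne_zero_of_isCoprime hcoprime (x j))) hS
  exact hequilibrium.exists_fin Subtype.val_injective fun a j h => hnotMem j (h ▸ a.2)
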